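/- Let $q\ge 2$ be a fixed integer. An arithmetic formula in the variables $x_1,\dots,x_n$ is a finite directed acyclic graph consisting of $+$ gates of unbounded fan-in, $\times$ gates of fan-in two, and terminal nodes, which are the variables (there are no constants and no subtractions), in which every gate has fan-out at most one, while a terminal node may feed several gates; a terminal node is joined to a $+$ gate by at most one edge, but may be both inputs of a $\times$ gate. Its size $s$ is the number of its $+$ and $\times$ gates (read as $1$ if the formula is a single variable). Such a formula computes a polynomial $F(x_1,\dots,x_n)$ with integer coefficients, whose sum-product expansion is its expansion into monomials. A monomial $x_{i_1}^{s_1}\cdots x_{i_t}^{s_t}$, with $x_{i_1},\dots,x_{i_t}$ the distinct variables that occur in it, is called a $q$-monomial if $1\le s_j\le q-1$ for all $j$; its degree is $s_1+\cdots+s_t$. There is a deterministic algorithm (a single random access program, charged at logarithmic cost) which, given $n$, an integer $k\ge 0$ and an arithmetic formula of size $s$ in $n$ variables, decides whether the sum-product expansion of the polynomial $F$ computed by the formula contains a $q$-monomial of degree $k$, and which runs in time $O^*(5.44^k s^4)$, where $O^*$ suppresses factors polynomial in $n$ and $k$; that is, there are constants $C,c$ depending only on $q$ such that the running time is at most $C\,(n+k+1)^c\cdot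 5.44^k\cdot s^4$ for all $n$, $k$ and all formulas. -/

import Mathlib

namespace QMonomial

/-! ### Arithmetic formulas -/

/-- Arithmetic formulas in `n` variables: terminal nodes are variables, `+` gates have unbounded
fan-in and `×` gates have fan-in two. As every gate has fan-out at most one, the gates form a tree;
a terminal node may feed several gates, so it is repeated wherever it is used. -/
inductive Formula (n : ℕ) : Type where
  | var (i : Fin n) : Formula n
  | add (l : List (Formula n)) : Formula n
  | mul (a b : Formula n) : Formula n

namespace Formula

variable {n : ℕ}

/-- The size of a formula: the number of its gates (terminal nodes are not gates). -/
def size : Formula n → ℕ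
  | var _ => 0
  | add l => 1 + (l.map fun φ => φ.size).sum
  | mul a b => 1 + a.size + b.size

/-- The variable of a terminal node; gates have none. -/
def terminal? : Formula n → Option (Fin n)
  | var i => some i
  | _ => none

/-- The underlying graph has no parallel edges into a `+` gate: a terminal node is connected to
a `+` gate by at most one edge. (Without this the number of gates would not bound the length of
the formula.) A `×` gate may take the same terminal node as both of its inputs. -/
def IsSimple : Formula n → Prop
  | var _ => True
  | add l => (l.filterMap terminal?).Nodup ∧ ∀ φ ∈ l, φ.IsSimple
  | mul a b => a.IsSimple ∧ b.IsSimple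

/-- The polynomial computed by a formula; its support is the set of monomials of the sum-product
expansion. -/
noncomputable def toPoly : Formula n → MvPolynomial (Fin n) ℤ
  | var i => MvPolynomial.X i
  | add l => (l.map fun φ => φ.toPoly).sum
  | mul a b => a.toPoly * b.toPoly

/-- A formula written in postfix notation, two numbers per node: the kind of the node
(`0` variable, `1` sum, `2` product), followed by the index of the variable or the fan-in. -/
def encode : Formula n → List ℕ
  | var i => [0, (i : ℕ)]
  | add l => (l.map fun φ => φ.encode).flatten ++ [1, l.length]
  | mul a b => a.encode ++ b.encode ++ [2, 2]

end Formula

/-! ### `q`-monomials -/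

/-- `x^m` is a `q`-monomial: every variable that occurs in it has exponent between `1` and
`q - 1`. -/
def IsQMonomial {n : ℕ} (q : ℕ) (m : Fin n →₀ ℕ) : Prop :=
  ∀ i ∈ m.support, 1 ≤ m i ∧ m i ≤ q - 1

/-- The sum-product expansion of `F` contains a `q`-monomial of degree `k`. -/
def HasQMonomial {n : ℕ} (q k : ℕ) (F : MvPolynomial (Fin n) ℤ) : Prop :=
  ∃ m ∈ F.support, IsQMonomial q m ∧ m.degree = k

/-! ### Deterministic random access programs with logarithmic (bit) cost -/

/-- The memory: registers and one-dimensional arrays holding natural numbers. A program names only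
finitely many registers and arrays, but the arrays are unbounded. -/
structure Memory where
  reg : ℕ → ℕ
  arr : ℕ → ℕ → ℕ

/-- Write `v` into register `x`. -/
def Memory.setReg (σ : Memory) (x v : ℕ) : Memory where
  reg := Function.update σ.reg x v
  arr := σ.arr

/-- Write `v` into cell `i` of array `a`. -/
def Memory.setArr (σ : Memory) (a i v : ℕ) : Memory where
  reg := σ.reg
  arr := Function.update σ.arr a (Function.update (σ.arr a) i v)

/-- Expressions. Subtraction is truncated, division is rounded down and `v / 0 = 0`. -/
inductive Expr : Type where
  | const (c : ℕ) : Expr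
  | reg (x : ℕ) : Expr
  | load (a : ℕ) (i : Expr) : Expr
  | add (e f : Expr) : Expr
  | sub (e f : Expr) : Expr
  | mul (e f : Expr) : Expr
  | div (e f : Expr) : Expr

/-- The cost of handling the number `v`: its binary length plus one. -/
def bits (v : ℕ) : ℕ := Nat.size v + 1

/-- The value of an expression. -/
def Expr.eval (σ : Memory) : Expr → ℕ
  | const c => c
  | reg x => σ.reg x
  | load a i => σ.arr a (i.eval σ)
  | add e f => e.eval σ + f.eval σ
  | sub e f => e.eval σ - f.eval σ
  | mul e f => e.eval σ * f.eval σ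
  | div e f => e.eval σ / f.eval σ

/-- The time to evaluate an expression: addition, subtraction and memory access are charged
linearly in the binary lengths of the numbers (and addresses) involved, multiplication and
division by the product of these lengths. -/
def Expr.cost (σ : Memory) : Expr → ℕ
  | const c => bits c
  | reg x => bits (σ.reg x)
  | load a i => i.cost σ + bits (i.eval σ) + bits (σ.arr a (i.eval σ))
  | add e f => e.cost σ + f.cost σ + bits (e.eval σ) + bits (f.eval σ)
  | sub e f => e.cost σ + f.cost σ + bits (e.eval σ) + bits (f.eval σ)
  | mul e f => e.cost σ + f.cost σ + bits (e.eval σ) * bits (f.eval σ)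
  | div e f => e.cost σ + f.cost σ + bits (e.eval σ) * bits (f.eval σ)

/-- Programs. `cond e P Q` runs `P` if `e ≠ 0` and `Q` otherwise; `loop e P` repeats `P` while
`e ≠ 0`. -/
inductive Program : Type where
  | skip : Program
  | assign (x : ℕ) (e : Expr) : Program
  | store (a : ℕ) (i e : Expr) : Program
  | seq (P Q : Program) : Program
  | cond (e : Expr) (P Q : Program) : Program
  | loop (e : Expr) (P : Program) : Program

/-- `Exec P σ τ t`: the program `P`, started in memory `σ`, halts in memory `τ` after time `t`. -/
inductive Exec : Program → Memory → Memory → ℕ → Prop where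
  | skip (σ : Memory) : Exec .skip σ σ 1
  | assign (x : ℕ) (e : Expr) (σ : Memory) :
      Exec (.assign x e) σ
        (σ.setReg x (e.eval σ))
        (e.cost σ + bits (e.eval σ) + 1)
  | store (a : ℕ) (i e : Expr) (σ : Memory) :
      Exec (.store a i e) σ
        (σ.setArr a (i.eval σ) (e.eval σ))
        (i.cost σ + e.cost σ + bits (i.eval σ) + bits (e.eval σ) + 1)
  | seq {P Q : Program} {σ τ ρ : Memory} {t u : ℕ} :
      Exec P σ τ t → Exec Q τ ρ u → Exec (.seq P Q) σ ρ (t + u)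
  | cond_true {e : Expr} {P Q : Program} {σ τ : Memory} {t : ℕ} :
      e.eval σ ≠ 0 → Exec P σ τ t → Exec (.cond e P Q) σ τ (e.cost σ + 1 + t)
  | cond_false {e : Expr} {P Q : Program} {σ τ : Memory} {t : ℕ} :
      e.eval σ = 0 → Exec Q σ τ t → Exec (.cond e P Q) σ τ (e.cost σ + 1 + t)
  | loop_stop {e : Expr} {P : Program} {σ : Memory} :
      e.eval σ = 0 → Exec (.loop e P) σ σ (e.cost σ + 1)
  | loop_step {e : Expr} {P : Program} {σ τ ρ : Memory} {t u : ℕ} :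
      e.eval σ ≠ 0 → Exec P σ τ t → Exec (.loop e P) τ ρ u →
        Exec (.loop e P) σ ρ (e.cost σ + 1 + t + u)

/-- The initial memory on input `(n, k, φ)`: registers `0`, `1`, `2` hold `n`, `k` and the length of
the encoding of `φ`, array `0` holds this encoding, and everything else is zero. -/
def input {n : ℕ} (k : ℕ) (φ : Formula n) : Memory where
  reg := fun x => if x = 0 then n else if x = 1 then k else if x = 2 then φ.encode.length else 0
  arr := fun a i => if a = 0 then φ.encode.getD i 0 else 0

end QMonomial

namespace QMonomial

/-! ### Bit counting -/

/-! Write r = q - 1. Split every variable x_i into r copies, numbered a = i * r + j with j < r, and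
replace x_i by their sum. A word (a monomial before variables commute) uses each variable at most r
times exactly when its letters can be replaced by pairwise distinct copies. Without subtraction,
words never cancel, so the question becomes whether some word of length k lifts to k distinct copies
(`hasQMonomial_iff_words`, `exists_nodup_isLift`, `count_le_of_isLift`).

Distinctness is tested in the exterior algebra Λ of ℤ^k. The copy a is sent to v_a ⊗ v_a in Λ ⊗ Λ,
with the Vandermonde vector v_a = (1, 2^a, 2^(2a), ...). A sequence of k copies contributes to the
top coefficient the square of a Vandermonde determinant: positive if the copies are distinct, zero
otherwise (`extProd_ne_zero_iff`). Squaring is what excludes cancellation without randomness; its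
price is the dimension 4^k, which is within 5.44^k. As the machine holds natural numbers only, each
basis element occurs with both signs, and the top coefficient is a difference of two entries
(`hasQMonomial_iff_states`).

Products of general elements of Λ ⊗ Λ are avoided: the formula is applied, as an operator, to a unit
vector. A variable is a sparse operator with at most 2 * 4^k * k^2 * r transitions, sums add
operators and products compose them. The program keeps vertices that carry vectors; a pending node
(φ, u, v) means "add φ applied to the vector at u to the vector at v". A sum hands (u, v) to its
children, a product inserts a fresh vertex. Since the gates form a tree, each node is handled once
(`runs_leaf`, `runs_node`, `runs_full`).

A formula of size s has N ≤ (n + 3) * max s 1 nodes (`nodes_le_mul_max`). The step count is at most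
quadratic in N, with a factor 4^k; bit lengths are linear in N and a step costs their square. This
gives the fourth power of the size. -/

/-- The number of ones in the binary expansion. -/
def bitCount (m : ℕ) : ℕ := if m = 0 then 0 else bitCount (m / 2) + m % 2
decreasing_by omega

theorem bitCount_zero : bitCount 0 = 0 := by rw [bitCount]; simp

theorem bitCount_eq (m : ℕ) : bitCount m = bitCount (m / 2) + m % 2 := by
  rcases eq_or_ne m 0 with rfl | h
  · simp [bitCount_zero]
  · conv_lhs => rw [bitCount]
    simp [h]

theorem bitCount_add_two_pow (d : ℕ) : ∀ m : ℕ, m / 2 ^ d % 2 = 0 →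
    bitCount (m + 2 ^ d) = bitCount m + 1 := by
  induction d with
  | zero =>
    intro m h
    rw [bitCount_eq (m + 2 ^ 0), bitCount_eq m]
    have h1 : m % 2 = 0 := by simpa using h
    have h2 : (m + 2 ^ 0) / 2 = m / 2 := by rw [pow_zero]; omega
    rw [h2, pow_zero]
    omega
  | succ d ih =>
    intro m h
    rw [bitCount_eq (m + 2 ^ (d + 1)), bitCount_eq m]
    have h1 : (m / 2) / 2 ^ d % 2 = 0 := by rwa [Nat.div_div_eq_div_mul, ← pow_succ']
    have h2 : (m + 2 ^ (d + 1)) / 2 = m / 2 + 2 ^ d := by rw [pow_succ]; omega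
    rw [h2, ih _ h1, pow_succ]
    omega

theorem bitCount_two_pow_sub_one (k : ℕ) : bitCount (2 ^ k - 1) = k := by
  induction k with
  | zero => simp [bitCount_zero]
  | succ k ih =>
    have h : 0 < 2 ^ k := by positivity
    have h1 : 2 ^ (k + 1) - 1 = (2 ^ k - 1) + 2 ^ k := by rw [pow_succ]; omega
    rw [h1, bitCount_add_two_pow, ih]
    rw [Nat.div_eq_of_lt (by omega)]

theorem bitCount_lt (m : ℕ) : bitCount m < m + 1 := by
  induction m using Nat.strong_induction_on with
  | _ m ih =>
    rcases eq_or_ne m 0 with rfl | h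
    · simp [bitCount_zero]
    · rw [bitCount_eq]
      have := ih (m / 2) (by omega)
      omega

theorem add_two_pow_div_of_lt {S s t : ℕ} (h : S / 2 ^ s % 2 = 0) (hst : s < t) :
    (S + 2 ^ s) / 2 ^ t = S / 2 ^ t := by
  obtain ⟨d, rfl⟩ := Nat.exists_eq_add_of_lt hst
  rw [show s + d + 1 = s + (d + 1) by ring, pow_add, ← Nat.div_div_eq_div_mul,
    ← Nat.div_div_eq_div_mul, Nat.add_div_right _ (by positivity), pow_succ',
    ← Nat.div_div_eq_div_mul, ← Nat.div_div_eq_div_mul]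
  congr 1
  omega

theorem add_two_pow_div_of_gt {S s t : ℕ} (hst : t < s) :
    (S + 2 ^ s) / 2 ^ t = S / 2 ^ t + 2 ^ (s - t) := by
  obtain ⟨d, rfl⟩ := Nat.exists_eq_add_of_lt hst
  rw [show t + d + 1 = t + (d + 1) by ring, pow_add, Nat.add_mul_div_left _ _ (by positivity)]
  congr 2
  omega

theorem add_two_pow_bit_of_ne {S s t : ℕ} (h : S / 2 ^ s % 2 = 0) (hst : s ≠ t) :
    (S + 2 ^ s) / 2 ^ t % 2 = S / 2 ^ t % 2 := by
  rcases lt_or_gt_of_ne hst with h1 | h1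
  · rw [add_two_pow_div_of_lt h h1]
  · rw [add_two_pow_div_of_gt h1]
    obtain ⟨d, hd⟩ : ∃ d, s - t = d + 1 := ⟨s - t - 1, by omega⟩
    rw [hd, pow_succ]
    omega

theorem add_two_pow_bit_self {S s : ℕ} (h : S / 2 ^ s % 2 = 0) :
    (S + 2 ^ s) / 2 ^ s % 2 = 1 := by
  rw [Nat.add_div_right _ (by positivity)]
  omega

theorem add_two_pow_lt {S s k : ℕ} (h : S / 2 ^ s % 2 = 0) (hs : s < k) (hS : S < 2 ^ k) :
    S + 2 ^ s < 2 ^ k := by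
  have h1 := add_two_pow_div_of_lt h hs
  rw [Nat.div_eq_of_lt hS] at h1
  exact (Nat.div_eq_zero_iff.1 h1).resolve_left (by positivity)

/-- The source of anticommutation: a new bit t changes the count above a lower bit s, whereas by
`add_two_pow_div_of_lt` a new bit s does not change the count above t. -/
theorem add_two_pow_bitCount {S s t : ℕ} (hst : s < t) (ht : S / 2 ^ t % 2 = 0) :
    bitCount ((S + 2 ^ t) / 2 ^ s) = bitCount (S / 2 ^ s) + 1 := by
  rw [add_two_pow_div_of_gt hst, bitCount_add_two_pow]
  rwa [Nat.div_div_eq_div_mul, ← pow_add, Nat.add_sub_cancel' hst.le]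

/-! ### Creation operators and determinants -/

/-- Multiplication by the vector `v` in the exterior algebra of `ℤ ^ k`, dualized: it acts on
functions of the bit masks that index the standard basis. -/
def creation (k : ℕ) : (Fin k → ℤ) →ₗ[ℤ] Module.End ℤ (ℕ → ℤ) :=
  LinearMap.mk₂ ℤ
    (fun v ψ S => ∑ s : Fin k, if S / 2 ^ (s : ℕ) % 2 = 0 then
      (-1) ^ bitCount (S / 2 ^ (s : ℕ)) * v s * ψ (S + 2 ^ (s : ℕ)) else 0)
    (fun v w ψ => by
      funext S
      simp only [Pi.add_apply, ← Finset.sum_add_distrib]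
      refine Finset.sum_congr rfl fun s _ => ?_
      split_ifs <;> ring)
    (fun c v ψ => by
      funext S
      simp only [Pi.smul_apply, smul_eq_mul, Finset.mul_sum]
      refine Finset.sum_congr rfl fun s _ => ?_
      split_ifs <;> ring)
    (fun v ψ χ => by
      funext S
      simp only [Pi.add_apply, ← Finset.sum_add_distrib]
      refine Finset.sum_congr rfl fun s _ => ?_
      split_ifs <;> ring)
    (fun c v ψ => by
      funext S
      simp only [Pi.smul_apply, smul_eq_mul, Finset.mul_sum]
      refine Finset.sum_congr rfl fun s _ => ?_
      split_ifs <;> ring)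

theorem creation_apply (k : ℕ) (v : Fin k → ℤ) (ψ : ℕ → ℤ) (S : ℕ) :
    creation k v ψ S = ∑ s : Fin k, if S / 2 ^ (s : ℕ) % 2 = 0 then
      (-1) ^ bitCount (S / 2 ^ (s : ℕ)) * v s * ψ (S + 2 ^ (s : ℕ)) else 0 := rfl

/-- Two bits added in either order reach the same mask with opposite signs, since the sign of a bit
counts the occupied bits above it; no bit can be added twice. This is v ∧ v = 0, the condition for
lifting to the exterior algebra. -/
theorem creation_mul_self (k : ℕ) (v : Fin k → ℤ) : creation k v * creation k v = 0 := by
  ext ψ S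
  rw [Module.End.mul_apply]
  -- The contribution of adding s and then t. It is antisymmetric in (s, t), so the double sum
  -- equals its own negative.
  let H : Fin k → Fin k → ℤ := fun s t =>
    if S / 2 ^ (s : ℕ) % 2 = 0 ∧ (S + 2 ^ (s : ℕ)) / 2 ^ (t : ℕ) % 2 = 0 then
      (-1) ^ (bitCount (S / 2 ^ (s : ℕ)) + bitCount ((S + 2 ^ (s : ℕ)) / 2 ^ (t : ℕ))) *
        (v s * v t) * ψ (S + 2 ^ (s : ℕ) + 2 ^ (t : ℕ)) else 0
  have hlt : ∀ s t : Fin k, s < t → H s t = -H t s := by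
    intro s t hst
    have hst' : (s : ℕ) < t := hst
    simp only [H]
    by_cases h1 : S / 2 ^ (s : ℕ) % 2 = 0
    · by_cases h2 : S / 2 ^ (t : ℕ) % 2 = 0
      · rw [if_pos ⟨h1, by rwa [add_two_pow_bit_of_ne h1 hst'.ne]⟩,
          if_pos ⟨h2, by rwa [add_two_pow_bit_of_ne h2 hst'.ne']⟩,
          add_two_pow_div_of_lt h1 hst', add_two_pow_bitCount hst' h2,
          add_right_comm S]
        ring
      · rw [if_neg, if_neg, neg_zero]
        · exact fun h => h2 h.1
        · rintro ⟨-, h⟩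
          exact h2 (by rwa [add_two_pow_bit_of_ne h1 hst'.ne] at h)
    · rw [if_neg (fun h => h1 h.1), if_neg, neg_zero]
      rintro ⟨h2, h⟩
      exact h1 (by rwa [add_two_pow_bit_of_ne h2 hst'.ne'] at h)
  have hanti : ∀ s t, H s t = -H t s := by
    intro s t
    rcases lt_trichotomy s t with h | rfl | h
    · exact hlt s t h
    · have : H s s = 0 := by
        simp only [H]
        rw [if_neg]
        rintro ⟨h1, h2⟩
        rw [add_two_pow_bit_self h1] at h2
        omega
      rw [this, neg_zero]
    · rw [hlt t s h, neg_neg]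
  have hsum : creation k v (creation k v ψ) S = ∑ s, ∑ t, H s t := by
    rw [creation_apply]
    refine Finset.sum_congr rfl fun s _ => ?_
    split_ifs with h
    · rw [creation_apply, Finset.mul_sum]
      refine Finset.sum_congr rfl fun t _ => ?_
      simp only [H, h, true_and]
      split_ifs
      · rw [pow_add]; ring
      · ring
    · symm
      refine Finset.sum_eq_zero fun t _ => ?_
      simp only [H]
      rw [if_neg (fun h' => h h'.1)]
  have hneg : ∑ s, ∑ t, H s t = -∑ s, ∑ t, H s t := by
    conv_lhs => rw [Finset.sum_comm]
    simp only [← Finset.sum_neg_distrib]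
    exact Finset.sum_congr rfl fun s _ => Finset.sum_congr rfl fun t _ => hanti t s
  rw [hsum]
  simp only [LinearMap.zero_apply, Pi.zero_apply]
  linarith

/-- The indicator of the full mask. -/
def fullMask (k : ℕ) (S : ℕ) : ℤ := if S = 2 ^ k - 1 then 1 else 0

/-- Adding the bits `0, …, m - 1` one after the other. -/
theorem prod_creation_single (k : ℕ) (ψ : ℕ → ℤ) : ∀ m (hm : m ≤ k),
    ((List.ofFn fun i : Fin m => creation k (Pi.single (Fin.castLE hm i) 1)).prod ψ) 0
      = ψ (2 ^ m - 1) := by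
  intro m
  induction m generalizing ψ with
  | zero => intro hm; simp
  | succ m ih =>
    intro hm
    rw [List.ofFn_succ', List.concat_eq_append, List.prod_append, List.prod_singleton,
      Module.End.mul_apply]
    have h0 := ih (creation k (Pi.single (Fin.castLE hm (Fin.last m)) 1) ψ) (by omega)
    have hp : 0 < 2 ^ m := by positivity
    refine Eq.trans h0 ?_
    rw [creation_apply, Finset.sum_eq_single (Fin.castLE hm (Fin.last m))]
    · have : (2 ^ m - 1) / 2 ^ m = 0 := Nat.div_eq_of_lt (by omega)
      simp only [Fin.val_castLE, Fin.val_last, this, bitCount_zero, Pi.single_eq_same]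
      rw [if_pos trivial, show 2 ^ m - 1 + 2 ^ m = 2 ^ (m + 1) - 1 by rw [pow_succ]; omega]
      ring
    · intro s _ hs
      rw [Pi.single_eq_of_ne hs]
      split_ifs <;> ring
    · simp

/-- By the universal property of the exterior algebra the left side is an alternating k-form in v.
On ℤ^k such a form is a multiple of the determinant, and `prod_creation_single` shows that the
factor is 1. -/
theorem prod_creation_eq_det (k : ℕ) (v : Fin k → Fin k → ℤ) :
    ((List.ofFn fun i => creation k (v i)).prod (fullMask k)) 0 = (Matrix.of v).det := by
  let ev : Module.End ℤ (ℕ → ℤ) →ₗ[ℤ] ℤ :=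
    (LinearMap.proj 0).comp (LinearMap.applyₗ (fullMask k))
  let F : (Fin k → ℤ) [⋀^Fin k]→ₗ[ℤ] ℤ :=
    (ev.comp (ExteriorAlgebra.lift ℤ ⟨creation k, creation_mul_self k⟩).toLinearMap).compAlternatingMap
      (ExteriorAlgebra.ιMulti ℤ k)
  have hF : ∀ w : Fin k → Fin k → ℤ,
      F w = ((List.ofFn fun i => creation k (w i)).prod (fullMask k)) 0 := by
    intro w
    simp only [F, ev, LinearMap.compAlternatingMap_apply, LinearMap.comp_apply,
      ExteriorAlgebra.ιMulti_apply, AlgHom.toLinearMap_apply, map_list_prod, List.map_ofFn]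
    simp [Function.comp_def]
  rw [← hF, F.eq_smul_basis_det (Pi.basisFun ℤ (Fin k))]
  have h1 : F (Pi.basisFun ℤ (Fin k)) = 1 := by
    rw [hF]
    have := prod_creation_single k (fullMask k) k le_rfl
    simp only [Fin.castLE_rfl, id] at this
    simp only [Pi.basisFun_apply]
    rw [this]
    simp [fullMask]
  rw [AlternatingMap.smul_apply, h1, one_smul, Pi.basisFun_det_apply]

/-- The exterior product of the Vandermonde vectors with nodes `2 ^ a`, `a ∈ α`. -/
def extProd (k : ℕ) (α : List ℕ) : ℕ → ℤ :=
  (α.map fun a => creation k fun s => ((2 : ℤ) ^ a) ^ (s : ℕ)).prod (fullMask k)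

theorem extProd_cons (k a : ℕ) (α : List ℕ) :
    extProd k (a :: α) = creation k (fun s => ((2 : ℤ) ^ a) ^ (s : ℕ)) (extProd k α) := by
  simp [extProd]

/-- Grading: each creation operator reads its argument at a mask with one more bit, and `fullMask`
lives on k bits. Hence words of the wrong length contribute nothing. -/
theorem length_of_extProd_ne_zero (k : ℕ) (α : List ℕ) : ∀ S, extProd k α S ≠ 0 →
    bitCount S + α.length = k := by
  induction α with
  | nil =>
    intro S h
    simp only [extProd, List.map_nil, List.prod_nil, Module.End.one_apply, fullMask] at h
    have : S = 2 ^ k - 1 := by by_contra h'; simp [h'] at h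
    rw [this, bitCount_two_pow_sub_one, List.length_nil, add_zero]
  | cons a α ih =>
    intro S h
    rw [extProd_cons, creation_apply] at h
    obtain ⟨s, -, hs⟩ := Finset.exists_ne_zero_of_sum_ne_zero h
    have hfree : S / 2 ^ (s : ℕ) % 2 = 0 := by by_contra h'; simp [h'] at hs
    rw [if_pos hfree] at hs
    have := ih _ (right_ne_zero_of_mul hs)
    rw [bitCount_add_two_pow _ _ hfree] at this
    rw [List.length_cons]
    omega

/-- In length k this is a Vandermonde determinant with nodes 2^a, which differ exactly when the
copies a do; other lengths are excluded by degree. -/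
theorem extProd_ne_zero_iff (k : ℕ) (α : List ℕ) :
    extProd k α 0 ≠ 0 ↔ α.length = k ∧ α.Nodup := by
  by_cases hl : α.length = k
  · subst hl
    have h1 : extProd α.length α 0 =
        (Matrix.vandermonde fun i : Fin α.length => (2 : ℤ) ^ α.get i).det := by
      have := prod_creation_eq_det α.length fun i s => ((2 : ℤ) ^ α.get i) ^ (s : ℕ)
      rw [show Matrix.vandermonde (fun i : Fin α.length => (2 : ℤ) ^ α.get i) =
        Matrix.of fun i (s : Fin α.length) => ((2 : ℤ) ^ α.get i) ^ (s : ℕ) from rfl, ← this, extProd]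
      have hmap : ∀ G : ℕ → Module.End ℤ (ℕ → ℤ), α.map G = List.ofFn (G ∘ α.get) := fun G => by
        rw [← List.map_ofFn, List.ofFn_get]
      rw [hmap]
      rfl
    rw [h1, Matrix.det_vandermonde_ne_zero_iff, List.nodup_iff_injective_get]
    simp only [true_and]
    constructor
    · intro h i j hij
      exact h (by simp only [hij])
    · intro h i j hij
      exact h (Int.pow_right_injective (by norm_num) hij)
  · refine ⟨fun h => absurd ?_ hl, fun h => absurd h.1 hl⟩
    have := length_of_extProd_ne_zero k α 0 h
    rwa [bitCount_zero, zero_add] at this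

/-! ### Words of a formula -/

namespace Formula

variable {n : ℕ}

/-- The type is nested through lists, so its recursor needs a second motive, chosen as "all members
satisfy P". -/
theorem induction {P : Formula n → Prop} (hvar : ∀ i, P (var i))
    (hadd : ∀ l, (∀ φ ∈ l, P φ) → P (add l)) (hmul : ∀ a b, P a → P b → P (mul a b)) :
    ∀ φ, P φ := by
  intro φ
  refine Formula.rec (motive_1 := P) (motive_2 := fun l => ∀ φ ∈ l, P φ) hvar hadd hmul
    (by simp) ?_ φ
  intro a l ha hl φ hφ
  rcases List.mem_cons.1 hφ with rfl | h
  · exact ha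
  · exact hl φ h

/-- The sum-product expansion, before commuting variables. -/
def words : Formula n → List (List (Fin n))
  | var i => [[i]]
  | add l => (l.map fun φ => φ.words).flatten
  | mul a b => a.words.flatMap fun x => b.words.map fun y => x ++ y

/-- The value of a formula in a semiring that need not be commutative. -/
def evalIn {R : Type*} [Semiring R] (g : Fin n → R) : Formula n → R
  | var i => g i
  | add l => (l.map fun φ => φ.evalIn g).sum
  | mul a b => a.evalIn g * b.evalIn g

/-- Distributivity preserves the order of factors, so one expansion serves both polynomials and the
noncommutative semiring of operators. -/
theorem evalIn_eq_sum_words {R : Type*} [Semiring R] (g : Fin n → R) (φ : Formula n) :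
    φ.evalIn g = (φ.words.map fun w => (w.map g).prod).sum := by
  induction φ using Formula.induction with
  | hvar i => simp [evalIn, words]
  | hadd l ih =>
    simp only [evalIn, words]
    induction l with
    | nil => simp
    | cons a l ihl =>
      simp only [List.map_cons, List.sum_cons, List.flatten_cons, List.map_append,
        List.sum_append]
      rw [ih a (by simp), ihl fun φ h => ih φ (by simp [h])]
  | hmul a b iha ihb =>
    simp only [evalIn, words]
    rw [iha, ihb]
    induction a.words with
    | nil => simp
    | cons x l ihl =>
      simp only [List.map_cons, List.sum_cons, List.flatMap_cons, List.map_append,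
        List.sum_append, List.map_map, add_mul, ihl]
      congr 1
      simp only [Function.comp_def, List.map_append, List.prod_append, List.sum_map_mul_left]

theorem toPoly_eq_evalIn (φ : Formula n) : φ.toPoly = φ.evalIn MvPolynomial.X := by
  induction φ using Formula.induction with
  | hvar i => simp [evalIn, toPoly]
  | hadd l ih =>
    simp only [evalIn, toPoly]
    rw [List.map_congr_left ih]
  | hmul a b iha ihb => simp only [evalIn, toPoly, iha, ihb]

end Formula

/-! ### From monomials of the polynomial to words, by positivity -/

theorem list_sum_nonneg_and_pos_iff {α : Type*} (f : α → ℤ) (hf : ∀ x, 0 ≤ f x) (l : List α) :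
    0 ≤ (l.map f).sum ∧ (0 < (l.map f).sum ↔ ∃ x ∈ l, 0 < f x) := by
  induction l with
  | nil => simp
  | cons a l ih =>
    have ha := hf a
    simp only [List.map_cons, List.sum_cons, List.mem_cons, exists_eq_or_imp, ← ih.2]
    refine ⟨by linarith [ih.1], ?_⟩
    have := ih.1
    omega

theorem prod_map_X {n : ℕ} (w : List (Fin n)) :
    (w.map (MvPolynomial.X : Fin n → MvPolynomial (Fin n) ℤ)).prod =
      MvPolynomial.monomial (w.map fun i => Finsupp.single i 1).sum 1 := by
  induction w with
  | nil => simp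
  | cons i w ih =>
    rw [List.map_cons, List.prod_cons, ih, List.map_cons, List.sum_cons, MvPolynomial.X,
      MvPolynomial.monomial_mul, one_mul]

theorem sum_map_single_apply {n : ℕ} (w : List (Fin n)) (j : Fin n) :
    (w.map fun i => Finsupp.single i 1).sum j = w.count j := by
  induction w with
  | nil => simp
  | cons i w ih =>
    rw [List.map_cons, List.sum_cons, Finsupp.add_apply, ih, List.count_cons, add_comm,
      Finsupp.single_apply]
    simp

theorem degree_sum_map_single {n : ℕ} (w : List (Fin n)) :
    (w.map fun i => (Finsupp.single i 1 : Fin n →₀ ℕ)).sum.degree = w.length := by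
  induction w with
  | nil => simp
  | cons i w ih => rw [List.map_cons, List.sum_cons, map_add, ih]; simp [add_comm]

/-- The coefficient of m counts the words whose letters commute to m, so it is nonzero as soon as
one such word exists. -/
theorem hasQMonomial_iff_words {n : ℕ} (r k : ℕ) (φ : Formula n) :
    HasQMonomial (r + 1) k φ.toPoly ↔
      ∃ w ∈ φ.words, w.length = k ∧ ∀ i, w.count i ≤ r := by
  have hsupp : ∀ m, m ∈ φ.toPoly.support ↔
      ∃ w ∈ φ.words, (w.map fun i => Finsupp.single i 1).sum = m := by
    intro m
    have hc : φ.toPoly.coeff m = (φ.words.map fun w =>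
        if (w.map fun i => Finsupp.single i 1).sum = m then (1 : ℤ) else 0).sum := by
      rw [φ.toPoly_eq_evalIn, φ.evalIn_eq_sum_words, ← MvPolynomial.coeffAddMonoidHom_apply,
        map_list_sum, List.map_map]
      refine congrArg List.sum (List.map_congr_left fun w _ => ?_)
      rw [Function.comp_apply, prod_map_X, MvPolynomial.coeffAddMonoidHom_apply,
        MvPolynomial.coeff_monomial]
    obtain ⟨h0, h1⟩ := list_sum_nonneg_and_pos_iff (fun w : List (Fin n) =>
      if (w.map fun i => Finsupp.single i 1).sum = m then (1 : ℤ) else 0)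
      (fun w => by split_ifs <;> norm_num) φ.words
    rw [MvPolynomial.mem_support_iff, hc, ← h0.lt_iff_ne', h1]
    refine exists_congr fun w => and_congr_right fun _ => ?_
    split_ifs with h <;> simp [h]
  constructor
  · rintro ⟨m, hm, hq, hd⟩
    obtain ⟨w, hw, rfl⟩ := (hsupp m).1 hm
    refine ⟨w, hw, by rw [← degree_sum_map_single, hd], fun i => ?_⟩
    by_cases hi : i ∈ (w.map fun i => (Finsupp.single i 1 : Fin n →₀ ℕ)).sum.support
    · have := (hq i hi).2
      rwa [sum_map_single_apply] at this
    · rw [Finsupp.notMem_support_iff, sum_map_single_apply] at hi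
      omega
  · rintro ⟨w, hw, hl, hc⟩
    refine ⟨_, (hsupp _).2 ⟨w, hw, rfl⟩, fun i hi => ?_, by rw [degree_sum_map_single, hl]⟩
    rw [Finsupp.mem_support_iff, sum_map_single_apply] at hi
    rw [sum_map_single_apply]
    have := hc i
    omega

/-! ### Splitting variables -/

/-- Every letter `i` of the first word is replaced by one of its copies `i * r + j`, `j < r`. -/
def IsLift {n : ℕ} (r : ℕ) (w : List (Fin n)) (α : List ℕ) : Prop :=
  List.Forall₂ (fun (i : Fin n) a => ∃ j < r, a = i * r + j) w α

theorem div_of_copy {i r j a : ℕ} (hj : j < r) (h : a = i * r + j) : a / r = i := by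
  subst h
  rw [mul_comm, Nat.mul_add_div (by omega), Nat.div_eq_of_lt hj, add_zero]

/-- The occurrences of i become distinct numbers in the interval [i * r, i * r + r), which has r
elements. -/
theorem count_le_of_isLift {n r : ℕ} {w : List (Fin n)} {α : List ℕ} (h : IsLift r w α)
    (hα : α.Nodup) (i : Fin n) : w.count i ≤ r := by
  have h1 : w.count i = (α.filter fun a => a / r = i).length := by
    clear hα
    induction h with
    | nil => simp
    | @cons i' a w α hia _ ih =>
      obtain ⟨j, hj, ha⟩ := hia
      rw [List.count_cons, ih, List.filter_cons, div_of_copy hj ha]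
      by_cases hii : i' = i
      · simp [hii]
      · simp [hii, Fin.val_inj]
  rw [h1]
  -- Division by r recovers the letter only for r > 0; for r = 0 there are no copies, and only the
  -- empty word has a lift.
  rcases Nat.eq_zero_or_pos r with rfl | hr
  · have : α = [] := by
      cases h with
      | nil => rfl
      | cons h _ => obtain ⟨j, hj, -⟩ := h; omega
    simp [this]
  · rw [← List.toFinset_card_of_nodup (hα.filter _)]
    refine (Finset.card_le_card (t := Finset.Ico (i * r) (i * r + r)) ?_).trans (by simp)
    intro a ha
    simp only [List.mem_toFinset, List.mem_filter, decide_eq_true_eq] at ha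
    have h2 := Nat.div_add_mod a r
    have h3 := Nat.mod_lt a hr
    rw [ha.2, mul_comm] at h2
    rw [Finset.mem_Ico]
    omega

/-- Number the occurrences of each letter from the right: an occurrence of i receives the copy whose
index is the count of i in the tail. -/
theorem exists_nodup_isLift {n r : ℕ} (w : List (Fin n)) (h : ∀ i, w.count i ≤ r) :
    ∃ α, IsLift r w α ∧ α.Nodup := by
  -- The added clause says that only copies with index below the current count are in use, which
  -- makes the next copy fresh.
  suffices ∃ α, IsLift r w α ∧ α.Nodup ∧
      ∀ a ∈ α, ∃ i j : ℕ, ∃ i' : Fin n, i = i' ∧ j < w.count i' ∧ a = i * r + j by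
    obtain ⟨α, h1, h2, -⟩ := this
    exact ⟨α, h1, h2⟩
  induction w with
  | nil => exact ⟨[], List.Forall₂.nil, by simp, by simp⟩
  | cons i w ih =>
    have hle : ∀ i', w.count i' ≤ (i :: w).count i' := fun i' => by
      rw [List.count_cons]; omega
    obtain ⟨α, h1, h2, h3⟩ := ih fun i' => (hle i').trans (h i')
    have hi := h i
    rw [List.count_cons_self] at hi
    refine ⟨(i * r + w.count i) :: α, List.Forall₂.cons ⟨_, by omega, rfl⟩ h1,
      List.nodup_cons.2 ⟨fun hmem => ?_, h2⟩, ?_⟩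
    · obtain ⟨_, j, i', rfl, hj, he⟩ := h3 _ hmem
      have hj' : j < r := hj.trans_le ((hle i').trans (h i'))
      have e1 := div_of_copy (by omega) (rfl : (i : ℕ) * r + w.count i = i * r + w.count i)
      have e2 := div_of_copy hj' he
      have e3 : i = i' := Fin.ext (e1.symm.trans e2)
      subst e3
      omega
    · intro a ha
      rcases List.mem_cons.1 ha with rfl | ha
      · exact ⟨i, w.count i, i, rfl, by simp, rfl⟩
      · obtain ⟨i₀, j, i', e, hj, he⟩ := h3 a ha
        exact ⟨i₀, j, i', e, hj.trans_le (hle i'), he⟩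

/-- Summation over all ways of replacing letters by copies. -/
def liftSum {n : ℕ} (r : ℕ) : List (Fin n) → (List ℕ → ℤ) →ₗ[ℤ] ℤ
  | [] => LinearMap.proj []
  | i :: w => ∑ j ∈ Finset.range r,
      (liftSum r w).comp (LinearMap.funLeft ℤ ℤ fun α => (i * r + j) :: α)

theorem liftSum_cons {n : ℕ} (r : ℕ) (i : Fin n) (w : List (Fin n)) (F : List ℕ → ℤ) :
    liftSum r (i :: w) F = ∑ j ∈ Finset.range r, liftSum r w fun α => F ((i * r + j) :: α) := by
  simp only [liftSum, LinearMap.sum_apply, LinearMap.comp_apply]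
  rfl

theorem liftSum_nonneg_and_pos_iff {n : ℕ} (r : ℕ) (w : List (Fin n)) :
    ∀ F : List ℕ → ℤ, (∀ α, 0 ≤ F α) →
      0 ≤ liftSum r w F ∧ (0 < liftSum r w F ↔ ∃ α, IsLift r w α ∧ 0 < F α) := by
  induction w with
  | nil =>
    intro F hF
    have : liftSum r ([] : List (Fin n)) F = F [] := rfl
    rw [this]
    refine ⟨hF _, ⟨fun h => ⟨[], List.Forall₂.nil, h⟩, ?_⟩⟩
    rintro ⟨α, hα, h⟩
    cases hα
    exact h
  | cons i w ih =>
    intro F hF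
    rw [liftSum_cons]
    have hj := fun j => ih (fun α => F ((i * r + j) :: α)) fun α => hF _
    refine ⟨Finset.sum_nonneg fun j _ => (hj j).1, ?_⟩
    rw [Finset.sum_pos_iff_of_nonneg fun j _ => (hj j).1]
    constructor
    · rintro ⟨j, hjr, h⟩
      obtain ⟨α, h1, h2⟩ := (hj j).2.1 h
      exact ⟨_, List.Forall₂.cons ⟨j, Finset.mem_range.1 hjr, rfl⟩ h1, h2⟩
    · rintro ⟨β, hβ, h⟩
      cases hβ with
      | cons hia hα =>
        obtain ⟨j, hjr, rfl⟩ := hia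
        exact ⟨j, Finset.mem_range.2 hjr, (hj j).2.2 ⟨_, hα, h⟩⟩

/-! ### The leaf operators -/

/-- The number of basis states: two masks of `k` bits and a sign. -/
def dim (k : ℕ) : ℕ := 2 ^ k * 2 ^ k * 2

/-- The first mask of a state. -/
def maskS (k X : ℕ) : ℕ := X / 2 / 2 ^ k

/-- The second mask of a state. -/
def maskT (k X : ℕ) : ℕ := X / 2 % 2 ^ k

/-- Bit `s` of the first mask and bit `t` of the second one are both zero. -/
abbrev IsFree (k X s t : ℕ) : Prop :=
  maskS k X / 2 ^ s % 2 = 0 ∧ maskT k X / 2 ^ t % 2 = 0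

/-- The state reached from `X` by adding bit `s` to the first and bit `t` to the second mask. -/
def target (k X s t : ℕ) : ℕ :=
  ((maskS k X + 2 ^ s) * 2 ^ k + (maskT k X + 2 ^ t)) * 2 +
    (bitCount (maskS k X / 2 ^ s) + bitCount (maskT k X / 2 ^ t) + X % 2) % 2

theorem maskT_lt (k X : ℕ) : maskT k X < 2 ^ k := Nat.mod_lt _ (by positivity)

theorem target_div_two (k X s t : ℕ) :
    target k X s t / 2 = (maskS k X + 2 ^ s) * 2 ^ k + (maskT k X + 2 ^ t) := by
  rw [target]; omega

theorem target_mod_two (k X s t : ℕ) : target k X s t % 2 =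
    (bitCount (maskS k X / 2 ^ s) + bitCount (maskT k X / 2 ^ t) + X % 2) % 2 := by
  rw [target]; omega

/-- Because bit t is free, the second mask stays below 2^k and nothing carries into the first one.
-/
theorem maskS_target {k X s t : ℕ} (h : IsFree k X s t) (ht : t < k) :
    maskS k (target k X s t) = maskS k X + 2 ^ s := by
  have h1 := add_two_pow_lt h.2 ht (maskT_lt k X)
  rw [maskS, target_div_two, mul_comm, Nat.mul_add_div (by positivity), Nat.div_eq_of_lt h1,
    add_zero]

theorem maskT_target {k X s t : ℕ} (h : IsFree k X s t) (ht : t < k) :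
    maskT k (target k X s t) = maskT k X + 2 ^ t := by
  have h1 := add_two_pow_lt h.2 ht (maskT_lt k X)
  rw [maskT, target_div_two, mul_comm, Nat.mul_add_mod, Nat.mod_eq_of_lt h1]

theorem maskS_lt {k X : ℕ} (h : X < dim k) : maskS k X < 2 ^ k := by
  rw [maskS, Nat.div_div_eq_div_mul]
  refine Nat.div_lt_of_lt_mul ?_
  rw [dim] at h
  linarith

theorem target_lt {k X s t : ℕ} (hX : X < dim k) (h : IsFree k X s t) (hs : s < k) (ht : t < k) :
    target k X s t < dim k := by
  have h1 := add_two_pow_lt h.2 ht (maskT_lt k X)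
  have h2 := add_two_pow_lt h.1 hs (maskS_lt hX)
  have h3 : (maskS k X + 2 ^ s + 1) * 2 ^ k ≤ 2 ^ k * 2 ^ k := Nat.mul_le_mul_right _ h2
  rw [add_mul, one_mul] at h3
  rw [target, dim]
  omega

/-- The contribution of the index `c = ((X * k + s) * k + t) * r + j` to the state `Z`. -/
def leafTerm (k r i : ℕ) (f : ℕ → ℕ) (Z c : ℕ) : ℕ :=
  if IsFree k (c / r / k / k) (c / r / k % k) (c / r % k) ∧
      target k (c / r / k / k) (c / r / k % k) (c / r % k) = Z then
    2 ^ ((i * r + c % r) * (c / r / k % k + c / r % k)) * f (c / r / k / k)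
  else 0

/-- Multiplication by the variable `i`, on functions of states. -/
def leafOp (k r i : ℕ) : AddMonoid.End (ℕ → ℕ) where
  toFun f Z := ∑ c ∈ Finset.range (dim k * k * k * r), leafTerm k r i f Z c
  map_zero' := by
    funext Z
    simp [leafTerm]
  map_add' f g := by
    funext Z
    rw [Pi.add_apply, ← Finset.sum_add_distrib]
    refine Finset.sum_congr rfl fun c _ => ?_
    simp only [leafTerm]
    split_ifs
    · rw [Pi.add_apply, mul_add]
    · rfl

theorem leafOp_apply (k r i : ℕ) (f : ℕ → ℕ) (Z : ℕ) : leafOp k r i f Z =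
    ∑ c ∈ Finset.range (dim k * k * k * r), leafTerm k r i f Z c := rfl

/-- The dual of `leafOp`. -/
def leafAdj (k r i : ℕ) (ψ : ℕ → ℤ) (X : ℕ) : ℤ :=
  ∑ s : Fin k, ∑ t : Fin k, ∑ j ∈ Finset.range r,
    if IsFree k X s t then 2 ^ ((i * r + j) * (s + t : ℕ)) * ψ (target k X s t) else 0

/-- The pairing of functions of states. -/
def pairing (k : ℕ) (f : ℕ → ℕ) (ψ : ℕ → ℤ) : ℤ := ∑ X ∈ Finset.range (dim k), (f X : ℤ) * ψ X

/-- Mixed radix: a single loop counter enumerates a product of ranges. -/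
theorem sum_range_mul_eq {M : Type*} [AddCommMonoid M] (a b : ℕ) (g : ℕ → ℕ → M) :
    ∑ c ∈ Finset.range (a * b), g (c / b) (c % b) =
      ∑ x ∈ Finset.range a, ∑ y ∈ Finset.range b, g x y := by
  induction a with
  | zero => simp
  | succ a ih =>
    rw [add_mul, one_mul, Finset.sum_range_add, ih, Finset.sum_range_succ]
    congr 1
    refine Finset.sum_congr rfl fun y hy => ?_
    rw [Finset.mem_range] at hy
    rw [mul_comm a b, Nat.mul_add_div (by omega), Nat.div_eq_of_lt hy, add_zero, Nat.mul_add_mod,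
      Nat.mod_eq_of_lt hy]

theorem leaf_index_bounds {k r c : ℕ} (hc : c < dim k * k * k * r) :
    c / r / k / k < dim k ∧ c / r / k % k < k ∧ c / r % k < k ∧ c % r < r := by
  have hr : 0 < r := Nat.pos_of_ne_zero fun h => by simp [h] at hc
  have hk : 0 < k := Nat.pos_of_ne_zero fun h => by simp [h] at hc
  refine ⟨?_, Nat.mod_lt _ hk, Nat.mod_lt _ hk, Nat.mod_lt _ hr⟩
  rw [Nat.div_lt_iff_lt_mul hk, Nat.div_lt_iff_lt_mul hk, Nat.div_lt_iff_lt_mul hr]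
  exact hc

/-- Each index c feeds at most one state, and that state is again below `dim k`. Passing to the
adjoint lets words be evaluated on functionals, where the exterior algebra computation lives. -/
theorem pairing_leafOp (k r i : ℕ) (f : ℕ → ℕ) (ψ : ℕ → ℤ) :
    pairing k (leafOp k r i f) ψ = pairing k f (leafAdj k r i ψ) := by
  let G : ℕ → ℕ → ℕ → ℕ → ℤ := fun X s t j =>
    if IsFree k X s t then f X * (2 ^ ((i * r + j) * (s + t)) * ψ (target k X s t)) else 0
  have h1 : pairing k (leafOp k r i f) ψ = ∑ c ∈ Finset.range (dim k * k * k * r),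
      G (c / r / k / k) (c / r / k % k) (c / r % k) (c % r) := by
    simp only [pairing, leafOp_apply, Nat.cast_sum, Finset.sum_mul]
    rw [Finset.sum_comm]
    refine Finset.sum_congr rfl fun c hc => ?_
    obtain ⟨hX, hs, ht, -⟩ := leaf_index_bounds (Finset.mem_range.1 hc)
    simp only [leafTerm, G]
    split_ifs with hf
    · rw [Finset.sum_eq_single (target k (c / r / k / k) (c / r / k % k) (c / r % k))]
      · rw [if_pos ⟨hf, rfl⟩]
        push_cast
        ring
      · intro Z _ hZ
        rw [if_neg fun h => hZ h.2.symm]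
        simp
      · intro h
        exact absurd (Finset.mem_range.2 (target_lt hX hf hs ht)) h
    · refine Finset.sum_eq_zero fun Z _ => ?_
      rw [if_neg fun h => hf h.1]
      simp
  -- The digits j, t, s of the counter are split off one after the other.
  rw [h1, sum_range_mul_eq (dim k * k * k) r
    fun c j => G (c / k / k) (c / k % k) (c % k) j, sum_range_mul_eq (dim k * k) k
    fun c t => ∑ j ∈ Finset.range r, G (c / k) (c % k) t j, sum_range_mul_eq (dim k) k
    fun X s => ∑ t ∈ Finset.range k, ∑ j ∈ Finset.range r, G X s t j]
  refine Finset.sum_congr rfl fun X _ => ?_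
  simp only [leafAdj, Finset.mul_sum, Finset.sum_range (n := k)]
  refine Finset.sum_congr rfl fun s _ => Finset.sum_congr rfl fun t _ =>
    Finset.sum_congr rfl fun j _ => ?_
  simp only [G]
  split_ifs
  · rfl
  · rw [mul_zero]

/-- The functional that reads off the signed coefficient of the two full masks. -/
def readOff (k X : ℕ) : ℤ := (-1) ^ (X % 2) * (fullMask k (maskS k X) * fullMask k (maskT k X))

theorem neg_one_pow_mod_two (m : ℕ) : (-1 : ℤ) ^ (m % 2) = (-1) ^ m := by
  rw [← neg_one_pow_eq_pow_mod_two]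

/-- For one copy a of a letter, the adjoint applies the creation operator of v_a in both masks at
once; summing over j produces `liftSum`. The sign bit of the state only contributes the factor in
front. -/
theorem foldr_leafAdj {n : ℕ} (k r : ℕ) (w : List (Fin n)) : ∀ X,
    w.foldr (fun (i : Fin n) ψ => leafAdj k r i ψ) (readOff k) X =
      (-1) ^ (X % 2) * liftSum r w fun α => extProd k α (maskS k X) * extProd k α (maskT k X) := by
  induction w with
  | nil =>
    intro X
    simp only [List.foldr_nil, readOff]
    rfl
  | cons i w ih =>
    intro X
    rw [List.foldr_cons, leafAdj, liftSum_cons, Finset.mul_sum]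
    simp only [ih]
    rw [Finset.sum_congr rfl fun s _ => Finset.sum_comm, Finset.sum_comm]
    refine Finset.sum_congr rfl fun j _ => ?_
    -- For a fixed copy a, the two creation operators are expanded over pairs of bits; the entries
    -- 2^(a * s) and 2^(a * t) merge into one power of two.
    have hext : (fun α => extProd k ((i * r + j) :: α) (maskS k X) *
        extProd k ((i * r + j) :: α) (maskT k X)) =
        ∑ s : Fin k, ∑ t : Fin k, (if IsFree k X s t then
          (-1) ^ (bitCount (maskS k X / 2 ^ (s : ℕ)) + bitCount (maskT k X / 2 ^ (t : ℕ))) *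
            (2 : ℤ) ^ ((i * r + j) * (s + t : ℕ)) else 0) •
          fun α => extProd k α (maskS k X + 2 ^ (s : ℕ)) *
            extProd k α (maskT k X + 2 ^ (t : ℕ)) := by
      funext α
      simp only [extProd_cons, creation_apply, Finset.sum_mul_sum, Finset.sum_apply,
        Pi.smul_apply, smul_eq_mul]
      refine Finset.sum_congr rfl fun s _ => Finset.sum_congr rfl fun t _ => ?_
      by_cases h1 : maskS k X / 2 ^ (s : ℕ) % 2 = 0
      · by_cases h2 : maskT k X / 2 ^ (t : ℕ) % 2 = 0
        · rw [if_pos h1, if_pos h2, if_pos ⟨h1, h2⟩]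
          ring
        · rw [if_neg h2, if_neg fun h : IsFree k X s t => h2 h.2]
          ring
      · rw [if_neg h1, if_neg fun h : IsFree k X s t => h1 h.1]
        ring
    rw [hext]
    simp only [map_sum, map_smul, Finset.mul_sum, smul_eq_mul]
    refine Finset.sum_congr rfl fun s _ => Finset.sum_congr rfl fun t _ => ?_
    split_ifs with hf
    · rw [maskS_target hf t.2, maskT_target hf t.2, target_mod_two, neg_one_pow_mod_two,
        pow_add _ _ (X % 2)]
      ring
    · ring

/-- Adjoints compose in the opposite order, hence `foldl`. The resulting reversal of words is
harmless, as lengths and letter counts ignore order. -/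
theorem pairing_prod_leafOp {n : ℕ} (k r : ℕ) (w : List (Fin n)) : ∀ (f : ℕ → ℕ) (ψ : ℕ → ℤ),
    pairing k ((w.map fun i : Fin n => leafOp k r i).prod f) ψ =
      pairing k f (w.foldl (fun ψ (i : Fin n) => leafAdj k r i ψ) ψ) := by
  induction w with
  | nil => intro f ψ; rfl
  | cons i w ih =>
    intro f ψ
    rw [List.map_cons, List.prod_cons, List.foldl_cons, ← ih, ← pairing_leafOp]
    rfl

theorem pairing_single (k : ℕ) (ψ : ℕ → ℤ) : pairing k (Pi.single 0 1) ψ = ψ 0 := by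
  rw [pairing, Finset.sum_eq_single 0]
  · simp
  · intro X _ hX
    rw [Pi.single_eq_of_ne hX]
    simp
  · intro h
    exact absurd (Finset.mem_range.2 (by rw [dim]; positivity)) h

/-- The two full masks with sign plus and minus are the last two states. -/
theorem pairing_readOff (k : ℕ) (f : ℕ → ℕ) :
    pairing k f (readOff k) = f (dim k - 2) - f (dim k - 1) := by
  have hp : 0 < 2 ^ k := by positivity
  have hpp : 2 ^ k ≤ 2 ^ k * 2 ^ k := Nat.le_mul_of_pos_left _ hp
  obtain ⟨d, hd⟩ : ∃ d, dim k = d + 1 + 1 := ⟨dim k - 2, by rw [dim]; omega⟩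
  -- In base 2^k, both digits of 4^k - 1 are 2^k - 1.
  have hq : 2 ^ k * 2 ^ k - 1 = 2 ^ k * (2 ^ k - 1) + (2 ^ k - 1) := by
    rw [Nat.mul_sub, mul_one]; omega
  have hS : (2 ^ k * 2 ^ k - 1) / 2 ^ k = 2 ^ k - 1 := by
    rw [hq, Nat.mul_add_div hp, Nat.div_eq_of_lt (by omega), add_zero]
  have hT : (2 ^ k * 2 ^ k - 1) % 2 ^ k = 2 ^ k - 1 := by
    rw [hq, Nat.mul_add_mod, Nat.mod_eq_of_lt (by omega)]
  have hd' := hd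
  rw [dim] at hd'
  have h0 : ∀ X, X < d → readOff k X = 0 := by
    intro X hX
    rw [readOff]
    by_contra hne
    have hne' := right_ne_zero_of_mul hne
    have e1 : maskS k X = 2 ^ k - 1 := by
      by_contra h; rw [fullMask, if_neg h] at hne'; simp at hne'
    have e2 : maskT k X = 2 ^ k - 1 := by
      by_contra h; rw [fullMask, fullMask, if_neg h] at hne'; simp at hne'
    have e3 := Nat.div_add_mod (X / 2) (2 ^ k)
    rw [maskS] at e1
    rw [maskT] at e2
    rw [e1, e2] at e3
    omega
  have h1 : readOff k d = 1 := by
    have e : d / 2 = 2 ^ k * 2 ^ k - 1 := by omega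
    have e' : d % 2 = 0 := by omega
    rw [readOff, maskS, maskT, e, e', hS, hT]
    simp [fullMask]
  have h2 : readOff k (d + 1) = -1 := by
    have e : (d + 1) / 2 = 2 ^ k * 2 ^ k - 1 := by omega
    have e' : (d + 1) % 2 = 1 := by omega
    rw [readOff, maskS, maskT, e, e', hS, hT]
    simp [fullMask]
  rw [pairing, hd, Finset.sum_range_succ, Finset.sum_range_succ, h1, h2,
    Finset.sum_eq_zero fun X hX => by rw [h0 X (Finset.mem_range.1 hX), mul_zero]]
  simp
  ring

/-- The formula contains a `q`-monomial of degree `k` if and only if its value in the algebra of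
states has a nonzero top coefficient. -/
theorem hasQMonomial_iff_states {n : ℕ} (r k : ℕ) (φ : Formula n) :
    HasQMonomial (r + 1) k φ.toPoly ↔
      φ.evalIn (fun i : Fin n => leafOp k r i) (Pi.single 0 1) (dim k - 1) <
        φ.evalIn (fun i : Fin n => leafOp k r i) (Pi.single 0 1) (dim k - 2) := by
  -- Squares: the sum over words and lifts is positive as soon as one term is nonzero.
  have hpos : ∀ α, 0 ≤ extProd k α 0 * extProd k α 0 := fun α => mul_self_nonneg _
  have key : pairing k (φ.evalIn (fun i : Fin n => leafOp k r i) (Pi.single 0 1)) (readOff k) =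
      (φ.words.map fun w => liftSum r w.reverse fun α => extProd k α 0 * extProd k α 0).sum := by
    have hw : ∀ w : List (Fin n),
        pairing k ((w.map fun i : Fin n => leafOp k r i).prod (Pi.single 0 1)) (readOff k) =
          liftSum r w.reverse fun α => extProd k α 0 * extProd k α 0 := by
      intro w
      rw [pairing_prod_leafOp, pairing_single, List.foldl_eq_foldr_reverse, foldr_leafAdj]
      simp [maskS, maskT]
    rw [φ.evalIn_eq_sum_words]
    induction φ.words with
    | nil =>
      simp [pairing]
    | cons w l ih =>
      rw [List.map_cons, List.sum_cons, List.map_cons, List.sum_cons, ← ih, ← hw]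
      simp only [pairing, ← Finset.sum_add_distrib, ← add_mul, ← Nat.cast_add]
      rfl
  rw [pairing_readOff] at key
  have h1 := list_sum_nonneg_and_pos_iff
    (fun w : List (Fin n) => liftSum r w.reverse fun α => extProd k α 0 * extProd k α 0)
    (fun w => (liftSum_nonneg_and_pos_iff r w.reverse _ hpos).1) φ.words
  rw [← key, sub_pos, Nat.cast_lt] at h1
  rw [h1.2, hasQMonomial_iff_words]
  refine exists_congr fun w => and_congr_right fun _ => ?_
  rw [(liftSum_nonneg_and_pos_iff r w.reverse _ hpos).2]
  constructor
  · rintro ⟨hl, hc⟩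
    obtain ⟨α, h2, h3⟩ := exists_nodup_isLift (r := r) w.reverse (by simpa using hc)
    refine ⟨α, h2, ?_⟩
    rw [mul_self_pos, extProd_ne_zero_iff]
    exact ⟨by rw [← h2.length_eq, List.length_reverse, hl], h3⟩
  · rintro ⟨α, h2, h3⟩
    rw [mul_self_pos, extProd_ne_zero_iff] at h3
    refine ⟨by rw [← h3.1, ← h2.length_eq, List.length_reverse], fun i => ?_⟩
    have := count_le_of_isLift h2 h3.2 i
    simpa using this

/-! ### Cost of programs on bounded memory -/

/-- All numbers in the memory have at most `L` bits, where `L` is positive. -/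
structure Bounded (L : ℕ) (σ : Memory) : Prop where
  one_le : 1 ≤ L
  reg_lt : ∀ x, σ.reg x < 2 ^ L
  arr_lt : ∀ a i, σ.arr a i < 2 ^ L

theorem Bounded.setReg {L : ℕ} {σ : Memory} (h : Bounded L σ) (x : ℕ) {v : ℕ} (hv : v < 2 ^ L) :
    Bounded L (σ.setReg x v) where
  one_le := h.one_le
  reg_lt y := by
    rcases eq_or_ne y x with rfl | hy
    · simpa [Memory.setReg] using hv
    · simpa [Memory.setReg, Function.update_of_ne hy] using h.reg_lt y
  arr_lt := h.arr_lt

theorem Bounded.setArr {L : ℕ} {σ : Memory} (h : Bounded L σ) (a i : ℕ) {v : ℕ}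
    (hv : v < 2 ^ L) : Bounded L (σ.setArr a i v) where
  one_le := h.one_le
  reg_lt := h.reg_lt
  arr_lt b j := by
    rcases eq_or_ne b a with rfl | hb
    · rcases eq_or_ne j i with rfl | hj
      · simpa [Memory.setArr] using hv
      · simpa [Memory.setArr, Function.update_of_ne hj] using h.arr_lt b j
    · simpa [Memory.setArr, Function.update_of_ne hb] using h.arr_lt b j

/-- The weight of an expression; it controls the size of its value and its cost. -/
def Expr.weight : Expr → ℕ
  | const c => c + 1
  | reg _ => 1
  | load _ i => i.weight + 1
  | add e f => e.weight + f.weight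
  | sub e f => e.weight + f.weight
  | mul e f => e.weight + f.weight
  | div e f => e.weight + f.weight

theorem Expr.one_le_weight (e : Expr) : 1 ≤ e.weight := by
  induction e <;> simp only [Expr.weight] <;> omega

theorem bits_le {v w L : ℕ} (hw : 1 ≤ w) (hL : 1 ≤ L) (h : v < 2 ^ (w * L)) :
    bits v ≤ 2 * (w * L) := by
  have h1 : Nat.size v ≤ w * L := Nat.size_le.2 h
  have h2 : 1 ≤ w * L := Nat.mul_pos hw hL
  rw [bits]
  omega

/-- Bit lengths at most add up under the arithmetic operations. A loaded value has at most L bits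
whatever its address; the remaining weight of a load pays for computing the address. -/
theorem Expr.eval_lt {L : ℕ} {σ : Memory} (h : Bounded L σ) (e : Expr) :
    e.eval σ < 2 ^ (e.weight * L) := by
  have hL := h.one_le
  have hmono : ∀ a b : ℕ, 2 ^ (a * L) ≤ 2 ^ ((a + b) * L) := fun a b =>
    Nat.pow_le_pow_right (by norm_num) (Nat.mul_le_mul_right _ (by omega))
  induction e with
  | const c =>
    simp only [Expr.eval, Expr.weight]
    calc c < 2 ^ (c + 1) := (Nat.lt_succ_self c).trans Nat.lt_two_pow_self
      _ ≤ 2 ^ ((c + 1) * L) := Nat.pow_le_pow_right (by norm_num) (Nat.le_mul_of_pos_right _ hL)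
  | reg x => simpa only [Expr.eval, Expr.weight, one_mul] using h.reg_lt x
  | load a i _ =>
    simp only [Expr.eval, Expr.weight]
    refine (h.arr_lt a _).trans_le (Nat.pow_le_pow_right (by norm_num) ?_)
    exact Nat.le_mul_of_pos_left _ (by omega)
  | add e f he hf =>
    simp only [Expr.eval, Expr.weight]
    rw [add_mul, pow_add]
    have h1 : 2 ≤ 2 ^ (e.weight * L) := by
      calc 2 = 2 ^ 1 := rfl
        _ ≤ _ := Nat.pow_le_pow_right (by norm_num) (Nat.mul_pos e.one_le_weight hL)
    have h2 : 2 ≤ 2 ^ (f.weight * L) := by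
      calc 2 = 2 ^ 1 := rfl
        _ ≤ _ := Nat.pow_le_pow_right (by norm_num) (Nat.mul_pos f.one_le_weight hL)
    nlinarith
  | sub e f he hf => exact ((Nat.sub_le _ _).trans_lt he).trans_le (hmono _ _)
  | mul e f he hf =>
    simp only [Expr.eval, Expr.weight]
    rw [add_mul, pow_add]
    exact Nat.mul_lt_mul'' he hf
  | div e f he hf => exact ((Nat.div_le_self _ _).trans_lt he).trans_le (hmono _ _)

theorem Expr.bits_eval_le {L : ℕ} {σ : Memory} (h : Bounded L σ) (e : Expr) :
    bits (e.eval σ) ≤ 2 * (e.weight * L) := bits_le e.one_le_weight h.one_le (e.eval_lt h)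

/-- Squaring the additive weight leaves a cross term, which pays for the product of bit lengths in a
multiplication or division. -/
theorem Expr.cost_le {L : ℕ} {σ : Memory} (h : Bounded L σ) (e : Expr) :
    e.cost σ ≤ 4 * (e.weight * L) ^ 2 := by
  have hL := h.one_le
  have key : ∀ e f : Expr, e.weight * L + f.weight * L ≤ 2 * (e.weight * L * (f.weight * L)) := by
    intro e f
    have h1 : 1 ≤ e.weight * L := Nat.mul_pos e.one_le_weight hL
    have h2 : 1 ≤ f.weight * L := Nat.mul_pos f.one_le_weight hL
    nlinarith
  induction e with
  | const c =>
    have h1 := Expr.bits_eval_le h (.const c)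
    have h2 : 1 ≤ (Expr.const c).weight * L := Nat.mul_pos (Expr.one_le_weight _) hL
    simp only [Expr.eval] at h1
    simp only [Expr.cost]
    nlinarith
  | reg x =>
    have h1 := Expr.bits_eval_le h (.reg x)
    have h2 : 1 ≤ (Expr.reg x).weight * L := Nat.mul_pos (Expr.one_le_weight _) hL
    simp only [Expr.eval] at h1
    simp only [Expr.cost]
    nlinarith
  | load a i hi =>
    have h1 := i.bits_eval_le h
    have h3 : bits (σ.arr a (i.eval σ)) ≤ 2 * (1 * L) :=
      bits_le le_rfl hL (by rw [one_mul]; exact h.arr_lt _ _)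
    have h2 : 1 ≤ i.weight * L := Nat.mul_pos i.one_le_weight hL
    simp only [Expr.cost, Expr.weight]
    nlinarith
  | add e f he hf =>
    have h1 := e.bits_eval_le h
    have h2 := f.bits_eval_le h
    have h3 := key e f
    simp only [Expr.cost, Expr.weight]
    nlinarith
  | sub e f he hf =>
    have h1 := e.bits_eval_le h
    have h2 := f.bits_eval_le h
    have h3 := key e f
    simp only [Expr.cost, Expr.weight]
    nlinarith
  | mul e f he hf =>
    have h1 := Nat.mul_le_mul (e.bits_eval_le h) (f.bits_eval_le h)
    simp only [Expr.cost, Expr.weight]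
    nlinarith
  | div e f he hf =>
    have h1 := Nat.mul_le_mul (e.bits_eval_le h) (f.bits_eval_le h)
    simp only [Expr.cost, Expr.weight]
    nlinarith

/-- The weight of a program; it bounds the cost of a single step, up to the bit lengths. -/
def Program.weight : Program → ℕ
  | skip => 1
  | assign _ e => 7 * e.weight ^ 2
  | store _ i e => 7 * (i.weight + e.weight) ^ 2
  | seq P Q => P.weight + Q.weight
  | cond e P Q => 5 * e.weight ^ 2 + (P.weight + Q.weight)
  | loop e P => 5 * e.weight ^ 2 + P.weight

/-- Started in `σ`, the program halts after at most `N` steps on numbers of at most `L` bits, in a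
memory that satisfies `Q`. -/
def Runs (L : ℕ) (P : Program) (σ : Memory) (N : ℕ) (Q : Memory → Prop) : Prop :=
  ∃ τ t, Exec P σ τ t ∧ t ≤ P.weight * L ^ 2 * N ∧ Q τ

namespace Runs

variable {L N N' : ℕ} {P P' : Program} {σ : Memory} {Q Q' : Memory → Prop} {e : Expr}

theorem mono (h : Runs L P σ N Q) (hN : N ≤ N') (hQ : ∀ τ, Q τ → Q' τ) : Runs L P σ N' Q' := by
  obtain ⟨τ, t, h1, h2, h3⟩ := h
  exact ⟨τ, t, h1, h2.trans (Nat.mul_le_mul_left _ hN), hQ τ h3⟩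

theorem skip (hL : 1 ≤ L) (h : Q σ) : Runs L .skip σ 1 Q := by
  refine ⟨σ, 1, Exec.skip σ, ?_, h⟩
  simp only [Program.weight]
  nlinarith

theorem test_cost_le (hB : Bounded L σ) (e : Expr) :
    e.cost σ + 1 ≤ 5 * e.weight ^ 2 * L ^ 2 := by
  have h1 := e.cost_le hB
  have h2 : 1 ≤ e.weight * L := Nat.mul_pos e.one_le_weight hB.one_le
  nlinarith

theorem assign {x : ℕ} (hB : Bounded L σ) (h : Q (σ.setReg x (e.eval σ))) :
    Runs L (.assign x e) σ 1 Q := by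
  refine ⟨_, _, Exec.assign x e σ, ?_, h⟩
  have h1 := e.cost_le hB
  have h2 := e.bits_eval_le hB
  have h3 : 1 ≤ e.weight * L := Nat.mul_pos e.one_le_weight hB.one_le
  simp only [Program.weight]
  nlinarith

theorem store {a : ℕ} {i : Expr} (hB : Bounded L σ) (h : Q (σ.setArr a (i.eval σ) (e.eval σ))) :
    Runs L (.store a i e) σ 1 Q := by
  refine ⟨_, _, Exec.store a i e σ, ?_, h⟩
  have h1 := e.cost_le hB
  have h2 := e.bits_eval_le hB
  have h3 : 1 ≤ e.weight * L := Nat.mul_pos e.one_le_weight hB.one_le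
  have h4 := i.cost_le hB
  have h5 := i.bits_eval_le hB
  have h6 : 1 ≤ i.weight * L := Nat.mul_pos i.one_le_weight hB.one_le
  simp only [Program.weight]
  nlinarith

theorem seq (h : Runs L P σ N fun τ => Runs L P' τ N' Q) : Runs L (.seq P P') σ (N + N') Q := by
  obtain ⟨τ, t, h1, h2, ρ, u, h3, h4, h5⟩ := h
  refine ⟨ρ, t + u, Exec.seq h1 h3, ?_, h5⟩
  simp only [Program.weight]
  have : (P.weight + P'.weight) * L ^ 2 * (N + N') = P.weight * L ^ 2 * N +
    P'.weight * L ^ 2 * N' + (P.weight * L ^ 2 * N' + P'.weight * L ^ 2 * N) := by ring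
  omega

theorem cond (hB : Bounded L σ) (h1 : e.eval σ ≠ 0 → Runs L P σ N Q)
    (h2 : e.eval σ = 0 → Runs L P' σ N Q) : Runs L (.cond e P P') σ (N + 1) Q := by
  have hc := test_cost_le hB e
  have hw : (5 * e.weight ^ 2 + (P.weight + P'.weight)) * L ^ 2 * (N + 1) =
      5 * e.weight ^ 2 * L ^ 2 + P.weight * L ^ 2 * N + P'.weight * L ^ 2 * N +
      (5 * e.weight ^ 2 * L ^ 2 * N + (P.weight + P'.weight) * L ^ 2) := by ring
  by_cases h : e.eval σ = 0
  · obtain ⟨τ, t, h3, h4, h5⟩ := h2 h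
    refine ⟨τ, _, Exec.cond_false h h3, ?_, h5⟩
    simp only [Program.weight]
    omega
  · obtain ⟨τ, t, h3, h4, h5⟩ := h1 h
    refine ⟨τ, _, Exec.cond_true h h3, ?_, h5⟩
    simp only [Program.weight]
    omega

/-- The invariant is indexed by the iteration, which fixes their number m. Each iteration pays for
its body and one test; the final 1 is the failing test. -/
theorem loop {m : ℕ} (I : ℕ → Memory → Prop)
    (hbody : ∀ i < m, ∀ τ, I i τ → Bounded L τ ∧ e.eval τ ≠ 0 ∧ Runs L P τ N (I (i + 1)))
    (hend : ∀ τ, I m τ → Bounded L τ ∧ e.eval τ = 0) (h0 : I 0 σ) :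
    Runs L (.loop e P) σ (m * (N + 1) + 1) (I m) := by
  suffices ∀ d i, i + d = m → ∀ τ, I i τ → Runs L (.loop e P) τ (d * (N + 1) + 1) (I m) from
    this m 0 (by omega) σ h0
  intro d
  induction d with
  | zero =>
    intro i hi τ hτ
    obtain rfl : i = m := by omega
    obtain ⟨hB, he⟩ := hend τ hτ
    have hc := test_cost_le hB e
    refine ⟨τ, _, Exec.loop_stop he, ?_, hτ⟩
    simp only [Program.weight]
    nlinarith
  | succ d ih =>
    intro i hi τ hτ
    obtain ⟨hB, he, ρ, t, h1, h2, h3⟩ := hbody i (by omega) τ hτ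
    obtain ⟨ρ', t', h4, h5, h6⟩ := ih (i + 1) (by omega) ρ h3
    have hc := test_cost_le hB e
    refine ⟨ρ', _, Exec.loop_step he h1 h4, ?_, h6⟩
    simp only [Program.weight] at h5 ⊢
    have : (5 * e.weight ^ 2 + P.weight) * L ^ 2 * ((d + 1) * (N + 1) + 1) =
      (5 * e.weight ^ 2 + P.weight) * L ^ 2 * (d * (N + 1) + 1) + 5 * e.weight ^ 2 * L ^ 2 +
      P.weight * L ^ 2 * N + (5 * e.weight ^ 2 * L ^ 2 * N + P.weight * L ^ 2) := by ring
    omega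

end Runs

/-! ### The program

Registers: `0` number of variables, `1` degree, `2` position in the code, `3` number of masks,
`4` loop counter, `5` height of the stack, `6` first unused vertex, `7` and `8` source and sink of
the current node, `9` argument of the current node. Arrays: `0` code, `1` values of vertices,
`2` powers of two, `3` bit counts, `4` and `5` stack of sources and sinks. -/

/-- The remainder. -/
def Expr.mod (e f : Expr) : Expr := .sub e (.mul (.div e f) f)

theorem Expr.eval_mod (σ : Memory) (e f : Expr) : (e.mod f).eval σ = e.eval σ % f.eval σ := by
  simp only [Expr.mod, Expr.eval]
  exact Nat.mod_eq_sub_div_mul.symm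

namespace Code

/-- The number of states. -/
def dimE : Expr := .mul (.mul (.reg 3) (.reg 3)) (.const 2)

/-- The source state encoded in the loop counter. -/
def stateE (r : ℕ) : Expr := .div (.div (.div (.reg 4) (.const r)) (.reg 1)) (.reg 1)

/-- The bit to be added to the first mask. -/
def bitS (r : ℕ) : Expr := .mod (.div (.div (.reg 4) (.const r)) (.reg 1)) (.reg 1)

/-- The bit to be added to the second mask. -/
def bitT (r : ℕ) : Expr := .mod (.div (.reg 4) (.const r)) (.reg 1)

/-- The first mask of the source state. -/
def maskSE (r : ℕ) : Expr := .div (.div (stateE r) (.const 2)) (.reg 3)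

/-- The second mask of the source state. -/
def maskTE (r : ℕ) : Expr := .mod (.div (stateE r) (.const 2)) (.reg 3)

/-- The first mask, shifted. -/
def shiftS (r : ℕ) : Expr := .div (maskSE r) (.load 2 (bitS r))

/-- The second mask, shifted. -/
def shiftT (r : ℕ) : Expr := .div (maskTE r) (.load 2 (bitT r))

/-- The address of the target state. -/
def targetE (r : ℕ) : Expr :=
  .add (.mul (.reg 8) dimE)
    (.add
      (.mul (.add (.mul (.add (maskSE r) (.load 2 (bitS r))) (.reg 3))
        (.add (maskTE r) (.load 2 (bitT r)))) (.const 2))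
      (.mod (.add (.add (.load 3 (shiftS r)) (.load 3 (shiftT r))) (.mod (stateE r) (.const 2)))
        (.const 2)))

/-- The coefficient of the transition. -/
def coefE (r : ℕ) : Expr :=
  .load 2 (.mul (.add (.mul (.reg 9) (.const r)) (.mod (.reg 4) (.const r)))
    (.add (bitS r) (bitT r)))

/-- The test that one of the two bits is occupied. -/
def occupiedE (r : ℕ) : Expr :=
  .add (.mod (shiftS r) (.const 2)) (.mod (shiftT r) (.const 2))

/-- Add one to the loop counter. -/
def incr : Program := .assign 4 (.add (.reg 4) (.const 1))

/-- The new value of the target address. -/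
def updateE (r : ℕ) : Expr :=
  .add (.load 1 (targetE r))
    (.mul (coefE r) (.load 1 (.add (.mul (.reg 7) dimE) (stateE r))))

/-- Add the value of the source, multiplied by the current variable, to the sink. -/
def leaf (r : ℕ) : Program :=
  .loop (.sub (.mul (.mul (.mul dimE (.reg 1)) (.reg 1)) (.const r)) (.reg 4))
    (.seq (.cond (occupiedE r) .skip (.store 1 (targetE r) (updateE r))) incr)

/-- Push copies of the current source and sink. -/
def push : Program :=
  .loop (.sub (.reg 9) (.reg 4))
    (.seq (.store 4 (.reg 5) (.reg 7)) (.seq (.store 5 (.reg 5) (.reg 8))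
      (.seq (.assign 5 (.add (.reg 5) (.const 1))) incr)))

end Code

/-! ### Correctness and cost of the two inner loops -/

/-- Agreement of two memories outside of given registers and arrays. -/
def SameExcept (R A : List ℕ) (σ τ : Memory) : Prop :=
  (∀ x, x ∉ R → τ.reg x = σ.reg x) ∧ ∀ a, a ∉ A → τ.arr a = σ.arr a

@[simp] theorem Memory.setReg_reg (σ : Memory) (x v y : ℕ) :
    (σ.setReg x v).reg y = if y = x then v else σ.reg y := by
  simp [Memory.setReg, Function.update_apply]

@[simp] theorem Memory.setReg_arr (σ : Memory) (x v : ℕ) : (σ.setReg x v).arr = σ.arr := rfl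

@[simp] theorem Memory.setArr_reg (σ : Memory) (a i v : ℕ) : (σ.setArr a i v).reg = σ.reg := rfl

@[simp] theorem Memory.setArr_arr (σ : Memory) (a i v b j : ℕ) :
    (σ.setArr a i v).arr b j = if b = a ∧ j = i then v else σ.arr b j := by
  by_cases h : b = a
  · subst h; simp [Memory.setArr, Function.update_apply]
  · simp [Memory.setArr, h]

theorem Memory.setArr_arr_of_ne (σ : Memory) {a b : ℕ} (i v : ℕ) (h : b ≠ a) :
    (σ.setArr a i v).arr b = σ.arr b := by
  simp [Memory.setArr, h]

/-- The contribution of the index `c` to the address `z`, for a leaf from `u` to `v`. -/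
def addrTerm (k r i u v : ℕ) (F : ℕ → ℕ) (z c : ℕ) : ℕ :=
  if IsFree k (c / r / k / k) (c / r / k % k) (c / r % k) ∧
      v * dim k + target k (c / r / k / k) (c / r / k % k) (c / r % k) = z then
    2 ^ ((i * r + c % r) * (c / r / k % k + c / r % k)) * F (u * dim k + c / r / k / k)
  else 0

/-- The exponent is a copy number below n * r times a sum of two bit positions below k. -/
theorem addrTerm_le {n k r i u v : ℕ} {F : ℕ → ℕ} {z c B : ℕ} (hi : i < n)
    (hc : c < dim k * k * k * r) (hF : ∀ a, F a ≤ B) :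
    addrTerm k r i u v F z c ≤ 2 ^ (2 * n * r * k) * B := by
  rw [addrTerm]
  split_ifs
  · refine Nat.mul_le_mul (Nat.pow_le_pow_right (by norm_num) ?_) (hF _)
    obtain ⟨-, hs, ht, hj⟩ := leaf_index_bounds hc
    calc (i * r + c % r) * (c / r / k % k + c / r % k) ≤ ((i + 1) * r) * (k + k) := by
          refine Nat.mul_le_mul ?_ (by omega)
          rw [add_mul]; omega
      _ ≤ (n * r) * (k + k) := Nat.mul_le_mul_right _ (Nat.mul_le_mul_right _ hi)
      _ = 2 * n * r * k := by ring
  · exact Nat.zero_le _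

/-- The update is in place: the loop writes only to the block of v and reads its source from the
block of u, so u ≠ v allows all terms to be formed from the initial memory. The last hypothesis
leaves room for all terms piling up in one cell. -/
theorem runs_leaf {L n k r i u v B : ℕ} {σ : Memory} (hB : Bounded L σ)
    (h1 : σ.reg 1 = k) (h3 : σ.reg 3 = 2 ^ k) (h4 : σ.reg 4 = 0) (h7 : σ.reg 7 = u)
    (h8 : σ.reg 8 = v) (h9 : σ.reg 9 = i) (hi : i < n) (huv : u ≠ v)
    (hpow : ∀ m ≤ 2 * n * r * k + k, σ.arr 2 m = 2 ^ m)
    (hbc : ∀ m < 2 ^ k, σ.arr 3 m = bitCount m)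
    (hval : ∀ a, σ.arr 1 a ≤ B)
    (hL1 : dim k * k * k * r < 2 ^ L)
    (hL2 : B + dim k * k * k * r * (2 ^ (2 * n * r * k) * B) < 2 ^ L) :
    Runs L (Code.leaf r) σ (dim k * k * k * r * 4 + 1) fun τ => Bounded L τ ∧
      SameExcept [4] [1] σ τ ∧ ∀ z, τ.arr 1 z = σ.arr 1 z +
        ∑ c ∈ Finset.range (dim k * k * k * r), addrTerm k r i u v (σ.arr 1) z c := by
  let I : ℕ → Memory → Prop := fun c τ => Bounded L τ ∧ τ.reg 4 = c ∧
      SameExcept [4] [1] σ τ ∧ ∀ z, τ.arr 1 z = σ.arr 1 z +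
        ∑ c ∈ Finset.range c, addrTerm k r i u v (σ.arr 1) z c
  have hdim : ∀ τ : Memory, τ.reg 3 = 2 ^ k → Code.dimE.eval τ = dim k := by
    intro τ h
    simp only [Code.dimE, Expr.eval, h, dim]
  have hbd : ∀ c ≤ dim k * k * k * r, ∀ z, σ.arr 1 z +
      ∑ c ∈ Finset.range c, addrTerm k r i u v (σ.arr 1) z c < 2 ^ L := by
    intro c hc z
    refine lt_of_le_of_lt (Nat.add_le_add (hval z) ?_) hL2
    calc ∑ c ∈ Finset.range c, addrTerm k r i u v (σ.arr 1) z c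
        ≤ ∑ _c ∈ Finset.range c, 2 ^ (2 * n * r * k) * B :=
          Finset.sum_le_sum fun c' hc' =>
            addrTerm_le hi ((Finset.mem_range.1 hc').trans_le hc) hval
      _ = c * (2 ^ (2 * n * r * k) * B) := by simp
      _ ≤ _ := Nat.mul_le_mul_right _ hc
  -- Written addresses lie in the block of v, so source cells receive nothing.
  have hsrc : ∀ c ≤ dim k * k * k * r, ∀ X < dim k,
      ∑ c ∈ Finset.range c, addrTerm k r i u v (σ.arr 1) (u * dim k + X) c = 0 := by
    intro c hc X hX
    refine Finset.sum_eq_zero fun c' hc' => ?_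
    obtain ⟨hX', hs, ht, -⟩ := leaf_index_bounds ((Finset.mem_range.1 hc').trans_le hc)
    rw [addrTerm, if_neg]
    rintro ⟨hf, he⟩
    have ht' := target_lt hX' hf hs ht
    refine huv ?_
    have e1 : (u * dim k + X) / dim k = u := by
      rw [mul_comm, Nat.mul_add_div (by omega), Nat.div_eq_of_lt hX, add_zero]
    rw [← e1, ← he, mul_comm, Nat.mul_add_div (by omega), Nat.div_eq_of_lt ht', add_zero]
  have main : Runs L (Code.leaf r) σ (dim k * k * k * r * (3 + 1) + 1)
      (I (dim k * k * k * r)) := by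
    refine Runs.loop I ?_ ?_ ⟨hB, h4, ⟨fun _ _ => rfl, fun _ _ => rfl⟩, by simp⟩
    · rintro c hc τ ⟨hBτ, hc4, ⟨hreg, harr⟩, hτ⟩
      have g1 : τ.reg 1 = k := by rw [hreg 1 (by decide), h1]
      have g3 : τ.reg 3 = 2 ^ k := by rw [hreg 3 (by decide), h3]
      have g7 : τ.reg 7 = u := by rw [hreg 7 (by decide), h7]
      have g8 : τ.reg 8 = v := by rw [hreg 8 (by decide), h8]
      have g9 : τ.reg 9 = i := by rw [hreg 9 (by decide), h9]
      have a2 : ∀ m ≤ 2 * n * r * k + k, τ.arr 2 m = 2 ^ m := by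
        rw [harr 2 (by decide)]; exact hpow
      have a3 : ∀ m < 2 ^ k, τ.arr 3 m = bitCount m := by
        rw [harr 3 (by decide)]; exact hbc
      have gd := hdim τ g3
      obtain ⟨hX, hs, ht, hj⟩ := leaf_index_bounds hc
      have eX : (Code.stateE r).eval τ = c / r / k / k := by
        simp only [Code.stateE, Expr.eval, hc4, g1]
      have es : (Code.bitS r).eval τ = c / r / k % k := by
        simp only [Code.bitS, Expr.eval_mod, Expr.eval, hc4, g1]
      have et : (Code.bitT r).eval τ = c / r % k := by
        simp only [Code.bitT, Expr.eval_mod, Expr.eval, hc4, g1]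
      have eS : (Code.maskSE r).eval τ = maskS k (c / r / k / k) := by
        simp only [Code.maskSE, Expr.eval, eX, g3, maskS]
      have eT : (Code.maskTE r).eval τ = maskT k (c / r / k / k) := by
        simp only [Code.maskTE, Expr.eval_mod, Expr.eval, eX, g3, maskT]
      have ps : τ.arr 2 (c / r / k % k) = 2 ^ (c / r / k % k) := a2 _ (by omega)
      have pt : τ.arr 2 (c / r % k) = 2 ^ (c / r % k) := a2 _ (by omega)
      have hS := maskS_lt hX
      have hT := maskT_lt k (c / r / k / k)
      have hterm : ∀ z, addrTerm k r i u v (σ.arr 1) z c =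
          if IsFree k (c / r / k / k) (c / r / k % k) (c / r % k) ∧
            v * dim k + target k (c / r / k / k) (c / r / k % k) (c / r % k) = z then
          2 ^ ((i * r + c % r) * (c / r / k % k + c / r % k)) * σ.arr 1 (u * dim k + c / r / k / k)
          else 0 := fun z => rfl
      have ej : (Expr.mod (.reg 4) (.const r)).eval τ = c % r := by
        simp only [Expr.eval_mod, Expr.eval, hc4]
      generalize c / r / k / k = X at *
      generalize c / r / k % k = s at *
      generalize c / r % k = t at *
      generalize c % r = j at *
      have eSs : (Code.shiftS r).eval τ = maskS k X / 2 ^ s := by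
        simp only [Code.shiftS, Expr.eval, eS, es, ps]
      have eTs : (Code.shiftT r).eval τ = maskT k X / 2 ^ t := by
        simp only [Code.shiftT, Expr.eval, eT, et, pt]
      have eocc : (Code.occupiedE r).eval τ = maskS k X / 2 ^ s % 2 + maskT k X / 2 ^ t % 2 := by
        simp only [Code.occupiedE, Expr.eval, Expr.eval_mod, eSs, eTs]
      have etgt : (Code.targetE r).eval τ = v * dim k + target k X s t := by
        simp only [Code.targetE, Expr.eval, Expr.eval_mod, eSs, eTs, eS, eT, es, et, ps, pt, g8, gd,
          g3, eX, target]
        rw [a3 _ ((Nat.div_le_self _ _).trans_lt hS), a3 _ ((Nat.div_le_self _ _).trans_lt hT)]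
      have hexp : (i * r + j) * (s + t) ≤ 2 * n * r * k + k := by
        calc (i * r + j) * (s + t) ≤ ((i + 1) * r) * (k + k) := by
              refine Nat.mul_le_mul ?_ (by omega)
              rw [add_mul]; omega
          _ ≤ (n * r) * (k + k) := Nat.mul_le_mul_right _ (Nat.mul_le_mul_right _ hi)
          _ = 2 * n * r * k := by ring
          _ ≤ _ := Nat.le_add_right _ _
      have ecoef : (Code.coefE r).eval τ = 2 ^ ((i * r + j) * (s + t)) := by
        simp only [Code.coefE, Expr.eval, ej, es, et, g9]
        exact a2 _ hexp
      have eupd : (Code.updateE r).eval τ = τ.arr 1 (v * dim k + target k X s t) +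
          2 ^ ((i * r + j) * (s + t)) * σ.arr 1 (u * dim k + X) := by
        simp only [Code.updateE, Expr.eval, ecoef, etgt, g7, gd, eX]
        rw [hτ (u * dim k + X), hsrc c hc.le X hX, add_zero]
      have hincr : ∀ ρ : Memory, Bounded L ρ → ρ.reg = τ.reg → (∀ a, a ≠ 1 → ρ.arr a = τ.arr a) →
          (∀ z, ρ.arr 1 z = σ.arr 1 z +
            ∑ c ∈ Finset.range (c + 1), addrTerm k r i u v (σ.arr 1) z c) →
          Runs L Code.incr ρ 1 (I (c + 1)) := by
        intro ρ hBρ hρ1 hρ2 hρ3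
        refine Runs.assign hBρ ?_
        have ev : (Expr.add (.reg 4) (.const 1)).eval ρ = c + 1 := by
          simp only [Expr.eval, hρ1, hc4]
        rw [ev]
        refine ⟨hBρ.setReg 4 (by omega), by simp, ⟨fun y hy => ?_, fun a ha => ?_⟩, hρ3⟩
        · simp only [List.mem_cons, List.not_mem_nil, or_false] at hy
          simp [hy, hρ1, hreg y (by simp [hy])]
        · simp only [List.mem_cons, List.not_mem_nil, or_false] at ha
          rw [Memory.setReg_arr, hρ2 a ha, harr a (by simp [ha])]
      refine ⟨hBτ, ?_, Runs.seq (N := 2) (N' := 1) (Runs.cond (N := 1) hBτ ?_ ?_)⟩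
      · simp only [Expr.eval, hc4, gd, g1]
        omega
      · intro hne
        refine Runs.skip hBτ.one_le (hincr τ hBτ rfl (fun _ _ => rfl) fun z => ?_)
        rw [Finset.sum_range_succ, hterm, if_neg, add_zero, hτ]
        rintro ⟨⟨f1, f2⟩, -⟩
        rw [eocc, f1, f2] at hne
        exact hne rfl
      · intro h0
        rw [eocc] at h0
        have hfree : IsFree k X s t := ⟨by omega, by omega⟩
        refine Runs.store hBτ ?_
        rw [etgt, eupd]
        have hnew : ∀ z, (τ.setArr 1 (v * dim k + target k X s t)
            (τ.arr 1 (v * dim k + target k X s t) +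
              2 ^ ((i * r + j) * (s + t)) * σ.arr 1 (u * dim k + X))).arr 1 z = σ.arr 1 z +
            ∑ c ∈ Finset.range (c + 1), addrTerm k r i u v (σ.arr 1) z c := by
          intro z
          rw [Memory.setArr_arr, Finset.sum_range_succ, hterm]
          by_cases hz : z = v * dim k + target k X s t
          · rw [if_pos ⟨rfl, hz⟩, if_pos ⟨hfree, hz.symm⟩, ← hz, hτ, add_assoc]
          · rw [if_neg fun h => hz h.2, if_neg fun h => hz h.2.symm, hτ, add_zero]
        refine hincr _ (hBτ.setArr _ _ ?_) rfl (fun a ha => Memory.setArr_arr_of_ne _ _ _ ha) hnew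
        have h1 := hnew (v * dim k + target k X s t)
        rw [Memory.setArr_arr, if_pos ⟨rfl, rfl⟩] at h1
        rw [h1]
        exact hbd (c + 1) hc _
    · rintro τ ⟨hBτ, hc4, ⟨hreg, harr⟩, hτ⟩
      refine ⟨hBτ, ?_⟩
      have g3 : τ.reg 3 = 2 ^ k := by rw [hreg 3 (by decide), h3]
      simp only [Expr.eval, hc4, hdim τ g3, hreg 1 (by decide), h1, Nat.sub_self]
  exact main.mono le_rfl fun τ h => ⟨h.1, h.2.2.1, h.2.2.2⟩

theorem runs_push {L u v sp x : ℕ} {σ : Memory} (hB : Bounded L σ) (h4 : σ.reg 4 = 0)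
    (h5 : σ.reg 5 = sp) (h7 : σ.reg 7 = u) (h8 : σ.reg 8 = v) (h9 : σ.reg 9 = x)
    (hL : sp + x < 2 ^ L) :
    Runs L Code.push σ (x * 5 + 1) fun τ => Bounded L τ ∧ SameExcept [4, 5] [4, 5] σ τ ∧
      τ.reg 5 = sp + x ∧
      (∀ a, τ.arr 4 a = if sp ≤ a ∧ a < sp + x then u else σ.arr 4 a) ∧
      ∀ a, τ.arr 5 a = if sp ≤ a ∧ a < sp + x then v else σ.arr 5 a := by
  let I : ℕ → Memory → Prop := fun c τ => Bounded L τ ∧ τ.reg 4 = c ∧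
      SameExcept [4, 5] [4, 5] σ τ ∧ τ.reg 5 = sp + c ∧
      (∀ a, τ.arr 4 a = if sp ≤ a ∧ a < sp + c then u else σ.arr 4 a) ∧
      ∀ a, τ.arr 5 a = if sp ≤ a ∧ a < sp + c then v else σ.arr 5 a
  have main : Runs L Code.push σ (x * (4 + 1) + 1) (I x) := by
    refine Runs.loop I ?_ ?_ ⟨hB, h4, ⟨fun _ _ => rfl, fun _ _ => rfl⟩, by simpa using h5, ?_, ?_⟩
    · rintro c hc τ ⟨hBτ, hc4, ⟨hreg, harr⟩, g5, ha4, ha5⟩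
      have g7 : τ.reg 7 = u := by rw [hreg 7 (by decide), h7]
      have g8 : τ.reg 8 = v := by rw [hreg 8 (by decide), h8]
      have g9 : τ.reg 9 = x := by rw [hreg 9 (by decide), h9]
      have hu : u < 2 ^ L := g7 ▸ hBτ.reg_lt 7
      have hv : v < 2 ^ L := g8 ▸ hBτ.reg_lt 8
      refine ⟨hBτ, by simp only [Expr.eval, g9, hc4]; omega, ?_⟩
      have b1 := hBτ.setArr 4 (sp + c) hu
      have b2 := b1.setArr 5 (sp + c) hv
      have b3 := b2.setReg 5 (v := sp + c + 1) (by omega)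
      have b4 := b3.setReg 4 (v := c + 1) (by omega)
      refine (Runs.seq (N := 1) (N' := 3) (Runs.store hBτ ?_))
      simp only [Expr.eval, g5, g7]
      refine (Runs.seq (N := 1) (N' := 2) (Runs.store b1 ?_))
      simp only [Expr.eval, Memory.setArr_reg, g5, g8]
      refine (Runs.seq (N := 1) (N' := 1) (Runs.assign b2 ?_))
      simp only [Expr.eval, Memory.setArr_reg, g5]
      refine Runs.assign b3 ?_
      simp only [Expr.eval, Memory.setReg_reg, Memory.setArr_reg, hc4]
      refine ⟨b4, by simp, ⟨fun y hy => ?_, fun a ha => ?_⟩, by simp [add_assoc], fun a => ?_,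
        fun a => ?_⟩
      · simp only [List.mem_cons, List.not_mem_nil, or_false, not_or] at hy
        simp [hy.1, hy.2, hreg y (by simp [hy.1, hy.2])]
      · simp only [List.mem_cons, List.not_mem_nil, or_false, not_or] at ha
        funext j
        simp [ha.1, ha.2, harr a (by simp [ha.1, ha.2])]
      · simp only [Memory.setReg_arr, Memory.setArr_arr, ha4]
        by_cases ha : a = sp + c
        · simp [ha]
        · have : a < sp + (c + 1) ↔ a < sp + c := by omega
          simp [ha, this]
      · simp only [Memory.setReg_arr, Memory.setArr_arr, ha5]
        by_cases ha : a = sp + c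
        · simp [ha]
        · have : a < sp + (c + 1) ↔ a < sp + c := by omega
          simp [ha, this]
    · rintro τ ⟨hBτ, hc4, ⟨hreg, harr⟩, -⟩
      refine ⟨hBτ, ?_⟩
      simp only [Expr.eval, hc4, hreg 9 (by decide), h9, Nat.sub_self]
    · intro a; rw [if_neg (by omega)]
    · intro a; rw [if_neg (by omega)]
  exact main.mono le_rfl fun τ h => ⟨h.1, h.2.2.1, h.2.2.2⟩

/-! ### Pending nodes -/

/-- The values of the vertices, as functions of states. -/
def block (k : ℕ) (F : ℕ → ℕ) (y X : ℕ) : ℕ := if X < dim k then F (y * dim k + X) else 0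

/-- The values of the vertices after all pending nodes (the last one first) have been processed:
a node with source `u` and sink `v` adds the value of `u`, multiplied by the formula, to `v`. -/
def process {n : ℕ} (k r : ℕ) (Δ : List (Formula n × ℕ × ℕ)) (val : ℕ → ℕ → ℕ) : ℕ → ℕ → ℕ :=
  Δ.foldr (fun p val => Function.update val p.2.2
    (val p.2.2 + p.1.evalIn (fun i : Fin n => leafOp k r i) (val p.2.1))) val

section process

variable {n k r : ℕ}

theorem process_append (Δ Δ' : List (Formula n × ℕ × ℕ)) (val : ℕ → ℕ → ℕ) :
    process k r (Δ ++ Δ') val = process k r Δ (process k r Δ' val) := by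
  simp [process]

/-- Pending nodes that name only vertices below w never see what is stored at w or beyond. -/
theorem process_congr {w : ℕ} (Δ : List (Formula n × ℕ × ℕ))
    (hΔ : ∀ p ∈ Δ, p.2.1 < w ∧ p.2.2 < w) {val val' : ℕ → ℕ → ℕ}
    (h : ∀ y < w, val y = val' y) : ∀ y < w, process k r Δ val y = process k r Δ val' y := by
  induction Δ with
  | nil => exact h
  | cons p Δ ih =>
    have ih' := ih fun p hp => hΔ p (by simp [hp])
    obtain ⟨h1, h2⟩ := hΔ p (by simp)
    intro y hy
    simp only [process, List.foldr_cons] at ih' ⊢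
    rcases eq_or_ne y p.2.2 with rfl | hne
    · rw [Function.update_self, Function.update_self, ih' _ h1, ih' _ h2]
    · rw [Function.update_of_ne hne, Function.update_of_ne hne, ih' _ hy]

/-- Since u ≠ v, the source keeps its value while the summands are added to the sink. -/
theorem process_add {u v : ℕ} (huv : u ≠ v) (l : List (Formula n)) (val : ℕ → ℕ → ℕ) :
    process k r (l.map fun φ => (φ, u, v)) val = process k r [(.add l, u, v)] val := by
  induction l with
  | nil => simp [process, Formula.evalIn]
  | cons a l ih =>
    have h1 : process k r ((a :: l).map fun φ => (φ, u, v)) val =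
        process k r [(a, u, v)] (process k r (l.map fun φ => (φ, u, v)) val) := by
      rw [← process_append]; rfl
    rw [h1, ih]
    simp only [process, List.foldr_cons, List.foldr_nil, Formula.evalIn, Function.update_self,
      Function.update_of_ne huv, Function.update_idem, List.map_cons, List.sum_cons]
    congr 1
    rw [add_assoc]
    congr 1
    exact add_comm _ _

/-- Operators compose from right to left: b carries u to the fresh vertex w, then a carries w to v.
The initial zero makes w hold exactly b applied to u. The two sides may differ at w itself, hence y
< w. -/
theorem process_mul {u v w : ℕ} (hv : v < w) (a b : Formula n)
    {val : ℕ → ℕ → ℕ} (hw : val w = 0) : ∀ y < w,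
    process k r [(a, w, v), (b, u, w)] val y = process k r [(.mul a b, u, v)] val y := by
  intro y hy
  simp only [process, List.foldr_cons, List.foldr_nil, Formula.evalIn, Function.update_self,
    Function.update_of_ne hv.ne, hw, zero_add]
  rcases eq_or_ne y v with rfl | hne
  · rw [Function.update_self, Function.update_self]
    rfl
  · rw [Function.update_of_ne hne, Function.update_of_ne hne, Function.update_of_ne hy.ne]

end process

/-- Target states stay below `dim k`, so an address determines its vertex and state, and the
address-level sum is the operator on one block. -/
theorem block_leaf {k r i u v : ℕ} {F G : ℕ → ℕ} (h : ∀ z, G z = F z +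
      ∑ c ∈ Finset.range (dim k * k * k * r), addrTerm k r i u v F z c) :
    block k G = Function.update (block k F) v
      (block k F v + leafOp k r i (block k F u)) := by
  funext y X
  have hterm : ∀ c < dim k * k * k * r, ∀ y, X < dim k →
      addrTerm k r i u v F (y * dim k + X) c =
        if y = v then leafTerm k r i (block k F u) X c else 0 := by
    intro c hc y hX
    obtain ⟨hX', hs, ht, -⟩ := leaf_index_bounds hc
    rw [addrTerm, leafTerm, block, if_pos hX']
    by_cases hf : IsFree k (c / r / k / k) (c / r / k % k) (c / r % k)
    · have ht' := target_lt hX' hf hs ht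
      by_cases hy : y = v
      · subst hy
        simp only [add_right_inj, if_true]
      · rw [if_neg hy, if_neg]
        rintro ⟨-, he⟩
        refine hy ?_
        have e1 : (y * dim k + X) / dim k = y := by
          rw [mul_comm, Nat.mul_add_div (by omega), Nat.div_eq_of_lt hX, add_zero]
        rw [← e1, ← he, mul_comm, Nat.mul_add_div (by omega), Nat.div_eq_of_lt ht', add_zero]
    · simp only [hf, false_and, if_false, ite_self]
  by_cases hX : X < dim k
  · rw [block, if_pos hX, h, Finset.sum_congr rfl fun c hc =>
      hterm c (Finset.mem_range.1 hc) y hX]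
    by_cases hy : y = v
    · subst hy
      rw [Function.update_self, Pi.add_apply, leafOp_apply, block, if_pos hX]
      simp
    · rw [Function.update_of_ne hy, block, if_pos hX]
      simp [hy]
  · rw [block, if_neg hX]
    by_cases hy : y = v
    · subst hy
      rw [Function.update_self, Pi.add_apply, leafOp_apply, block, if_neg hX, zero_add]
      symm
      refine Finset.sum_eq_zero fun c hc => ?_
      obtain ⟨hX', hs, ht, -⟩ := leaf_index_bounds (Finset.mem_range.1 hc)
      rw [leafTerm, if_neg]
      rintro ⟨hf, he⟩
      exact hX (he ▸ target_lt hX' hf hs ht)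
    · rw [Function.update_of_ne hy, block, if_neg hX]

/-! ### Length of the code -/

namespace Formula

variable {n : ℕ}

/-- The number of nodes, gates and terminals. -/
def nodes : Formula n → ℕ
  | var _ => 1
  | add l => 1 + (l.map fun φ => φ.nodes).sum
  | mul a b => 1 + a.nodes + b.nodes

theorem nodes_pos (φ : Formula n) : 0 < φ.nodes := by
  cases φ <;> simp only [nodes] <;> omega

theorem length_encode (φ : Formula n) : φ.encode.length = 2 * φ.nodes := by
  induction φ using Formula.induction with
  | hvar i => simp [encode, nodes]
  | hadd l ih =>
    simp only [encode, nodes, List.length_append, List.length_flatten, List.map_map]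
    rw [List.map_congr_left (g := fun φ => 2 * φ.nodes) ih, List.sum_map_mul_left]
    simp
    ring
  | hmul a b iha ihb =>
    simp only [encode, nodes, List.length_append, iha, ihb]
    simp
    ring

/-- Charge each terminal to the gate it feeds: a sum has at most n terminal inputs, as they are
distinct, and a product at most two. The last summand covers a root that is itself a terminal. -/
theorem nodes_le (φ : Formula n) (h : φ.IsSimple) :
    φ.nodes ≤ (n + 3) * φ.size + φ.terminal?.toList.length := by
  induction φ using Formula.induction with
  | hvar i => simp [nodes, size, terminal?]
  | hadd l ih =>
    rw [IsSimple] at h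
    have h1 : (l.map fun φ => φ.nodes).sum ≤
        (n + 3) * (l.map fun φ => φ.size).sum + (l.filterMap terminal?).length := by
      have h2 := h.2
      clear h
      induction l with
      | nil => simp
      | cons a l ihl =>
        have h3 := ihl (fun φ hφ => ih φ (by simp [hφ])) fun φ hφ => h2 φ (by simp [hφ])
        have h4 := ih a (by simp) (h2 a (by simp))
        have h5 : ((a :: l).filterMap terminal?).length =
            a.terminal?.toList.length + (l.filterMap terminal?).length := by
          rw [List.filterMap_cons]
          cases a.terminal? <;> simp [add_comm]
        simp only [List.map_cons, List.sum_cons, mul_add] at h3 ⊢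
        omega
    have h6 : (l.filterMap terminal?).length ≤ n := by
      simpa using h.1.length_le_card
    simp only [nodes, size, terminal?, Option.toList_none, List.length_nil, mul_add]
    omega
  | hmul a b iha ihb =>
    rw [IsSimple] at h
    have h1 := iha h.1
    have h2 := ihb h.2
    have h3 : a.terminal?.toList.length ≤ 1 := by cases a.terminal? <;> simp
    have h4 : b.terminal?.toList.length ≤ 1 := by cases b.terminal? <;> simp
    simp only [nodes, size, terminal?, Option.toList_none, List.length_nil, mul_add]
    omega

theorem nodes_le_mul_max (φ : Formula n) (h : φ.IsSimple) :
    φ.nodes ≤ (n + 3) * max φ.size 1 := by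
  have h1 := φ.nodes_le h
  cases φ with
  | var i => simp [nodes, size]
  | add l =>
    simp only [terminal?, Option.toList_none, List.length_nil, add_zero] at h1
    exact h1.trans (Nat.mul_le_mul_left _ (le_max_left _ _))
  | mul a b =>
    simp only [terminal?, Option.toList_none, List.length_nil, add_zero] at h1
    exact h1.trans (Nat.mul_le_mul_left _ (le_max_left _ _))

theorem nodes_le_of_mem {l : List (Formula n)} {φ : Formula n} (h : φ ∈ l) :
    φ.nodes ≤ (l.map fun φ => φ.nodes).sum :=
  List.le_sum_of_mem (List.mem_map_of_mem h)

theorem length_le_sum_nodes (l : List (Formula n)) :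
    l.length ≤ (l.map fun φ => φ.nodes).sum := by
  induction l with
  | nil => simp
  | cons a l ih =>
    have := a.nodes_pos
    simp only [List.length_cons, List.map_cons, List.sum_cons]
    omega

theorem le_of_mem_encode (φ : Formula n) : ∀ x ∈ φ.encode, x ≤ n + φ.nodes + 1 := by
  induction φ using Formula.induction with
  | hvar i =>
    intro x hx
    have := i.2
    simp only [encode, List.mem_cons, List.not_mem_nil, or_false] at hx
    omega
  | hadd l ih =>
    intro x hx
    have := length_le_sum_nodes l
    simp only [encode, List.mem_append, List.mem_flatten, List.mem_map, List.mem_cons,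
      List.not_mem_nil, or_false] at hx
    simp only [nodes]
    rcases hx with ⟨_, ⟨φ, hφ, rfl⟩, hx⟩ | rfl | rfl
    · have h1 := ih φ hφ x hx
      have h2 := nodes_le_of_mem hφ
      omega
    · omega
    · omega
  | hmul a b iha ihb =>
    intro x hx
    have ha := a.nodes_pos
    simp only [encode, List.mem_append, List.mem_cons, List.not_mem_nil, or_false] at hx
    simp only [nodes]
    rcases hx with (hx | hx) | hx
    · have := iha x hx; omega
    · have := ihb x hx; omega
    · omega

end Formula

/-! ### Processing one node -/

namespace Code

/-- Pop the stack and read the next node. -/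
def fetch : Program :=
  .seq (.assign 2 (.sub (.reg 2) (.const 2))) (.seq (.assign 5 (.sub (.reg 5) (.const 1)))
    (.seq (.assign 7 (.load 4 (.reg 5))) (.seq (.assign 8 (.load 5 (.reg 5)))
      (.seq (.assign 9 (.load 0 (.add (.reg 2) (.const 1)))) (.assign 4 (.const 0))))))

/-- Push the two factors of a product, connected by a fresh vertex. -/
def mulGate : Program :=
  .seq (.store 4 (.reg 5) (.reg 6)) (.seq (.store 5 (.reg 5) (.reg 8))
    (.seq (.store 4 (.add (.reg 5) (.const 1)) (.reg 7))
      (.seq (.store 5 (.add (.reg 5) (.const 1)) (.reg 6))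
        (.seq (.assign 5 (.add (.reg 5) (.const 2))) (.assign 6 (.add (.reg 6) (.const 1)))))))

/-- Process one node of the formula. -/
def node (r : ℕ) : Program :=
  .seq fetch (.cond (.load 0 (.reg 2))
    (.cond (.sub (.load 0 (.reg 2)) (.const 1)) mulGate push) (leaf r))

end Code

theorem runs_fetch {L p m u v x : ℕ} {τ : Memory} (hB : Bounded L τ) (h2 : τ.reg 2 = p + 2)
    (h5 : τ.reg 5 = m + 1) (hu : τ.arr 4 m = u) (hv : τ.arr 5 m = v) (hx : τ.arr 0 (p + 1) = x) :
    Runs L Code.fetch τ 6 fun σ => Bounded L σ ∧ SameExcept [2, 4, 5, 7, 8, 9] [] τ σ ∧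
      σ.reg 2 = p ∧ σ.reg 4 = 0 ∧ σ.reg 5 = m ∧ σ.reg 7 = u ∧ σ.reg 8 = v ∧ σ.reg 9 = x := by
  have l2 := hB.reg_lt 2
  have l5 := hB.reg_lt 5
  have b1 := hB.setReg 2 (v := p) (by omega)
  have b2 := b1.setReg 5 (v := m) (by omega)
  have b3 := b2.setReg 7 (v := u) (hu ▸ hB.arr_lt _ _)
  have b4 := b3.setReg 8 (v := v) (hv ▸ hB.arr_lt _ _)
  have b5 := b4.setReg 9 (v := x) (hx ▸ hB.arr_lt _ _)
  have b6 := b5.setReg 4 (v := 0) (by positivity)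
  refine Runs.seq (N := 1) (N' := 5) (Runs.assign hB ?_)
  simp only [Expr.eval, h2, Nat.add_sub_cancel]
  refine Runs.seq (N := 1) (N' := 4) (Runs.assign b1 ?_)
  simp only [Expr.eval, Memory.setReg_reg, h5, Nat.add_sub_cancel,
    Nat.reduceEqDiff, if_false]
  refine Runs.seq (N := 1) (N' := 3) (Runs.assign b2 ?_)
  simp only [Expr.eval, Memory.setReg_reg, Memory.setReg_arr, if_true, hu]
  refine Runs.seq (N := 1) (N' := 2) (Runs.assign b3 ?_)
  simp only [Expr.eval, Memory.setReg_reg, Memory.setReg_arr, Nat.reduceEqDiff, if_false,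
    if_true, hv]
  refine Runs.seq (N := 1) (N' := 1) (Runs.assign b4 ?_)
  simp only [Expr.eval, Memory.setReg_reg, Memory.setReg_arr, Nat.reduceEqDiff, if_false,
    if_true, hx]
  refine Runs.assign b5 ?_
  simp only [Expr.eval]
  refine ⟨b6, ⟨fun y hy => ?_, fun a _ => rfl⟩, ?_⟩
  · simp only [List.mem_cons, List.not_mem_nil, or_false, not_or] at hy
    simp [hy]
  · simp

theorem runs_mulGate {L m w u v : ℕ} {σ : Memory} (hB : Bounded L σ) (h5 : σ.reg 5 = m)
    (h6 : σ.reg 6 = w) (h7 : σ.reg 7 = u) (h8 : σ.reg 8 = v) (hm : m + 2 < 2 ^ L)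
    (hw : w + 1 < 2 ^ L) :
    Runs L Code.mulGate σ 6 fun τ => Bounded L τ ∧ SameExcept [5, 6] [4, 5] σ τ ∧
      τ.reg 5 = m + 2 ∧ τ.reg 6 = w + 1 ∧
      (∀ a, τ.arr 4 a = if a = m + 1 then u else if a = m then w else σ.arr 4 a) ∧
      ∀ a, τ.arr 5 a = if a = m + 1 then w else if a = m then v else σ.arr 5 a := by
  have hu : u < 2 ^ L := h7 ▸ hB.reg_lt 7
  have hv : v < 2 ^ L := h8 ▸ hB.reg_lt 8
  have b1 := hB.setArr 4 m (v := w) (by omega)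
  have b2 := b1.setArr 5 m hv
  have b3 := b2.setArr 4 (m + 1) hu
  have b4 := b3.setArr 5 (m + 1) (v := w) (by omega)
  have b5 := b4.setReg 5 hm
  have b6 := b5.setReg 6 hw
  refine Runs.seq (N := 1) (N' := 5) (Runs.store hB ?_)
  simp only [Expr.eval, h5, h6]
  refine Runs.seq (N := 1) (N' := 4) (Runs.store b1 ?_)
  simp only [Expr.eval, Memory.setArr_reg, h5, h8]
  refine Runs.seq (N := 1) (N' := 3) (Runs.store b2 ?_)
  simp only [Expr.eval, Memory.setArr_reg, h5, h7]
  refine Runs.seq (N := 1) (N' := 2) (Runs.store b3 ?_)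
  simp only [Expr.eval, Memory.setArr_reg, h5, h6]
  refine Runs.seq (N := 1) (N' := 1) (Runs.assign b4 ?_)
  simp only [Expr.eval, Memory.setArr_reg, h5]
  refine Runs.assign b5 ?_
  simp only [Expr.eval, Memory.setReg_reg, Memory.setArr_reg, h6, Nat.reduceEqDiff, if_false]
  refine ⟨b6, ⟨fun y hy => ?_, fun a ha => ?_⟩, ?_, ?_, fun a => ?_, fun a => ?_⟩
  · simp only [List.mem_cons, List.not_mem_nil, or_false, not_or] at hy
    simp [hy]
  · simp only [List.mem_cons, List.not_mem_nil, or_false, not_or] at ha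
    funext j
    simp [ha]
  · simp
  · simp
  · simp
  · simp

/-- The numeric data of a run: `L` bounds bit lengths and `g` the growth of the values per node. -/
structure Params (n k r N g L : ℕ) : Prop where
  growth : 1 + dim k * k * k * r * 2 ^ (2 * n * r * k) ≤ 2 ^ g
  values : g * N < L
  leaves : dim k * k * k * r < 2 ^ L
  stack : 2 * N + 3 < 2 ^ L

/-- The invariant of the main loop after `i` nodes of the formula `φ` have been processed. -/
structure MainInv {n : ℕ} (k r g L : ℕ) (φ : Formula n) (i : ℕ) (τ : Memory)
    (Δ : List (Formula n × ℕ × ℕ)) (w : ℕ) : Prop where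
  bounded : Bounded L τ
  reg1 : τ.reg 1 = k
  reg3 : τ.reg 3 = 2 ^ k
  pow : ∀ m ≤ 2 * n * r * k + k, τ.arr 2 m = 2 ^ m
  count : ∀ m < 2 ^ k, τ.arr 3 m = bitCount m
  code : τ.arr 0 = fun j => φ.encode.getD j 0
  reg2 : τ.reg 2 = (Δ.map fun p => p.1.encode).flatten.length
  done : τ.reg 2 + 2 * i = 2 * φ.nodes
  isPrefix : (Δ.map fun p => p.1.encode).flatten <+: φ.encode
  reg5 : τ.reg 5 = Δ.length
  stack : ∀ j p, Δ[j]? = some p → τ.arr 4 j = p.2.1 ∧ τ.arr 5 j = p.2.2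
  reg6 : τ.reg 6 = w
  two_le : 2 ≤ w
  le_two_add : w ≤ i + 2
  vertices : ∀ p ∈ Δ, p.2.1 < w ∧ p.2.2 < w ∧ p.2.1 ≠ p.2.2
  unused : ∀ z, w * dim k ≤ z → τ.arr 1 z = 0
  value_le : ∀ z, τ.arr 1 z ≤ 2 ^ (g * i)
  value : process k r Δ (block k (τ.arr 1)) 1 =
    φ.evalIn (fun i : Fin n => leafOp k r i) (Pi.single 0 1)

/-- Every pending formula owns at least two unread code entries. This bounds the stack height and
empties the stack when the code is exhausted. -/
theorem length_le_length_flatten_encode {n : ℕ} (Δ : List (Formula n × ℕ × ℕ)) :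
    2 * Δ.length ≤ (Δ.map fun p => p.1.encode).flatten.length := by
  induction Δ with
  | nil => simp
  | cons p Δ ih =>
    have := p.1.nodes_pos
    simp only [List.map_cons, List.flatten_cons, List.length_append, List.length_cons,
      Formula.length_encode]
    omega

theorem getD_of_prefix {P l : List ℕ} {a b : ℕ} (h : P ++ [a, b] <+: l) :
    l.getD P.length 0 = a ∧ l.getD (P.length + 1) 0 = b := by
  obtain ⟨t, rfl⟩ := h
  constructor <;> simp [List.getD_eq_getElem?_getD]

theorem block_eq_zero {k w : ℕ} {F : ℕ → ℕ} (h : ∀ z, w * dim k ≤ z → F z = 0) :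
    block k F w = 0 := by
  funext X
  rw [block]
  split_ifs
  · exact h _ (Nat.le_add_right _ _)
  · rfl

/-- Postfix code is read from its end, so the root of the last pending formula comes first, and
removing it leaves the concatenated codes of its children on top of the older ones. The last child
is finished before its siblings are touched; for a product this completes the fresh vertex before it
is used as a source. -/
theorem runs_node {n k r g L i w : ℕ} {φ : Formula n} (hP : Params n k r φ.nodes g L) {τ : Memory}
    {Δ : List (Formula n × ℕ × ℕ)} (hi : i < φ.nodes) (h : MainInv k r g L φ i τ Δ w) :
    Runs L (Code.node r) τ (6 + (dim k * k * k * r * 4 + 10 * φ.nodes + 6 + 1 + 1)) fun σ =>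
      ∃ Δ' w', MainInv k r g L φ (i + 1) σ Δ' w' := by
  have hdone := h.done
  have hlen := h.reg2
  obtain ⟨Δ', ⟨ψ, u, v⟩, rfl⟩ : ∃ Δ' p, Δ = Δ' ++ [p] := by
    rcases List.eq_nil_or_concat Δ with rfl | ⟨Δ', p, rfl⟩
    · simp at hlen
      omega
    · exact ⟨Δ', p, by simp⟩
  obtain ⟨hu, hv, huv⟩ := h.vertices (ψ, u, v) (by simp)
  have hvert : ∀ p ∈ Δ', p.2.1 < w ∧ p.2.2 < w ∧ p.2.1 ≠ p.2.2 :=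
    fun p hp => h.vertices p (by simp [hp])
  simp only at hu hv huv
  -- The last two entries describe the root of the popped formula; `pre` is the code of its
  -- children.
  obtain ⟨pre, kind, x, hψ, hcases⟩ : ∃ pre kind x, ψ.encode = pre ++ [kind, x] ∧
      ((∃ i, ψ = .var i ∧ pre = [] ∧ kind = 0 ∧ x = (i : ℕ)) ∨
      (∃ l, ψ = .add l ∧ pre = (l.map fun φ => φ.encode).flatten ∧ kind = 1 ∧ x = l.length) ∨
      ∃ a b, ψ = .mul a b ∧ pre = a.encode ++ b.encode ∧ kind = 2) := by
    cases ψ with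
    | var i => exact ⟨[], 0, i, by simp [Formula.encode], .inl ⟨i, rfl, rfl, rfl, rfl⟩⟩
    | add l => exact ⟨_, 1, l.length, Formula.encode.eq_2 l, .inr (.inl ⟨l, rfl, rfl, rfl, rfl⟩)⟩
    | mul a b => exact ⟨_, 2, 2, Formula.encode.eq_3 a b, .inr (.inr ⟨a, b, rfl, rfl, rfl⟩)⟩
  set P := (Δ'.map fun p => p.1.encode).flatten ++ pre with hPdef
  have hcode : ((Δ' ++ [(ψ, u, v)]).map fun p => p.1.encode).flatten = P ++ [kind, x] := by
    simp [hψ, hPdef]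
  have hpre := h.isPrefix
  rw [hcode] at hpre hlen
  obtain ⟨hkind, hx⟩ := getD_of_prefix hpre
  have hpre' : P <+: φ.encode := (List.prefix_append _ _).trans hpre
  have hPlen : τ.reg 2 = P.length + 2 := by simpa using hlen
  have hst := h.stack Δ'.length (ψ, u, v) (by simp)
  simp only at hst
  refine Runs.seq (N := 6) (Runs.mono (runs_fetch h.bounded hPlen (by simpa using h.reg5) hst.1
    hst.2 (x := x) (by rw [h.code]; exact hx)) le_rfl ?_)
  rintro σ ⟨hB, ⟨hreg, harr⟩, s2, s4, s5, s7, s8, s9⟩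
  have harr' : ∀ a, σ.arr a = τ.arr a := fun a => harr a (by simp)
  have s1 : σ.reg 1 = k := by rw [hreg 1 (by decide), h.reg1]
  have s3 : σ.reg 3 = 2 ^ k := by rw [hreg 3 (by decide), h.reg3]
  have s6 : σ.reg 6 = w := by rw [hreg 6 (by decide), h.reg6]
  have ekind : (Expr.load 0 (.reg 2)).eval σ = kind := by
    simp only [Expr.eval, s2, harr', h.code, hkind]
  have hstack' : ∀ j p, Δ'[j]? = some p → σ.arr 4 j = p.2.1 ∧ σ.arr 5 j = p.2.2 := by
    intro j p hj
    rw [harr', harr']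
    refine h.stack j p ?_
    rw [List.getElem?_append_left (List.getElem?_eq_some_iff.1 hj).1, hj]
  have hval := h.value
  rw [process_append] at hval
  have hmono : 2 ^ (g * i) ≤ 2 ^ (g * (i + 1)) :=
    Nat.pow_le_pow_right (by norm_num) (Nat.mul_le_mul_left _ (Nat.le_succ i))
  have hstk := hP.stack
  have hPle : P.length + 2 * (i + 1) = 2 * φ.nodes := by omega
  have hw := h.le_two_add
  rcases hcases with ⟨j, rfl, rfl, rfl, rfl⟩ | ⟨l, rfl, rfl, rfl, rfl⟩ | ⟨a, b, rfl, rfl, rfl⟩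
  · refine Runs.cond hB (fun hne => absurd ekind hne) (fun _ => ?_)
    -- One leaf multiplies the bound on all values by at most 2^g.
    have hB2 : 2 ^ (g * i) + dim k * k * k * r * (2 ^ (2 * n * r * k) * 2 ^ (g * i)) ≤
        2 ^ (g * (i + 1)) := by
      have := Nat.mul_le_mul_right (2 ^ (g * i)) hP.growth
      rw [← pow_add] at this
      calc _ = (1 + dim k * k * k * r * 2 ^ (2 * n * r * k)) * 2 ^ (g * i) := by ring
        _ ≤ 2 ^ (g + g * i) := this
        _ = _ := by rw [mul_add, mul_one, add_comm]
    have hgL : 2 ^ (g * (i + 1)) < 2 ^ L := by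
      refine Nat.pow_lt_pow_right (by norm_num) (lt_of_le_of_lt ?_ hP.values)
      exact Nat.mul_le_mul_left _ hi
    refine Runs.mono (runs_leaf (B := 2 ^ (g * i)) hB s1 s3 s4 s7 s8 s9 j.2 huv
      (by rw [harr']; exact h.pow) (by rw [harr']; exact h.count)
      (by rw [harr']; exact h.value_le) hP.leaves (hB2.trans_lt hgL)) (by omega) ?_
    rintro ρ ⟨hBρ, ⟨hreg', harrρ⟩, hρ⟩
    rw [harr'] at hρ
    have hcode' : (Δ'.map fun p => p.1.encode).flatten = P := by simp [hPdef]
    refine ⟨Δ', w, ?_⟩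
    exact
      { bounded := hBρ
        reg1 := by rw [hreg' 1 (by decide), s1]
        reg3 := by rw [hreg' 3 (by decide), s3]
        pow := by rw [harrρ 2 (by decide), harr']; exact h.pow
        count := by rw [harrρ 3 (by decide), harr']; exact h.count
        code := by rw [harrρ 0 (by decide), harr', h.code]
        reg2 := by rw [hreg' 2 (by decide), s2, hcode']
        done := by rw [hreg' 2 (by decide), s2, hPle]
        isPrefix := by rwa [hcode']
        reg5 := by rw [hreg' 5 (by decide), s5]
        stack := by rw [harrρ 4 (by decide), harrρ 5 (by decide)]; exact hstack'
        reg6 := by rw [hreg' 6 (by decide), s6]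
        two_le := h.two_le
        le_two_add := by omega
        vertices := hvert
        unused := by
          intro z hz
          rw [hρ, h.unused z hz, zero_add]
          refine Finset.sum_eq_zero fun c hc => ?_
          obtain ⟨hX', hs, ht, -⟩ := leaf_index_bounds (Finset.mem_range.1 hc)
          rw [addrTerm, if_neg]
          rintro ⟨hf, he⟩
          have ht' := target_lt hX' hf hs ht
          have h1 : (v + 1) * dim k ≤ w * dim k := Nat.mul_le_mul_right _ hv
          rw [add_mul] at h1
          omega
        value_le := by
          intro z
          rw [hρ]
          refine le_trans (Nat.add_le_add (h.value_le z) ?_) hB2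
          calc _ ≤ ∑ _c ∈ Finset.range (dim k * k * k * r), 2 ^ (2 * n * r * k) * 2 ^ (g * i) :=
                Finset.sum_le_sum fun c hc =>
                  addrTerm_le j.2 (Finset.mem_range.1 hc) h.value_le
            _ = _ := by simp
        value := by
          have e : process k r [(.var j, u, v)] (block k (τ.arr 1)) = block k (ρ.arr 1) := by
            rw [block_leaf hρ]
            simp only [process, List.foldr_cons, List.foldr_nil, Formula.evalIn]
          rw [← e]
          exact hval }
  · refine Runs.cond hB (fun _ => Runs.cond hB (fun hne2 => absurd ?_ hne2) (fun _ => ?_))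
      (fun he => absurd (ekind.symm.trans he) (by norm_num))
    · simp only [Expr.eval] at ekind ⊢
      rw [ekind]
    have hcode' : ((Δ' ++ l.map fun ψ => (ψ, u, v)).map fun p => p.1.encode).flatten = P := by
      simp [hPdef, Function.comp_def]
    have hlenΔ' := length_le_length_flatten_encode (Δ' ++ l.map fun ψ => (ψ, u, v))
    rw [hcode', List.length_append, List.length_map] at hlenΔ'
    refine Runs.mono (runs_push hB s4 s5 s7 s8 s9 (by omega)) (by omega) ?_
    rintro ρ ⟨hBρ, ⟨hreg', harrρ⟩, hρ5, hρ4, hρ5'⟩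
    refine ⟨Δ' ++ l.map fun ψ => (ψ, u, v), w, ?_⟩
    exact
      { bounded := hBρ
        reg1 := by rw [hreg' 1 (by decide), s1]
        reg3 := by rw [hreg' 3 (by decide), s3]
        pow := by rw [harrρ 2 (by decide), harr']; exact h.pow
        count := by rw [harrρ 3 (by decide), harr']; exact h.count
        code := by rw [harrρ 0 (by decide), harr', h.code]
        reg2 := by rw [hreg' 2 (by decide), s2, hcode']
        done := by rw [hreg' 2 (by decide), s2, hPle]
        isPrefix := by rwa [hcode']
        reg5 := by simp [hρ5]
        stack := by
          intro j p hj
          rw [hρ4, hρ5']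
          rcases lt_or_ge j Δ'.length with hjl | hjl
          · rw [List.getElem?_append_left hjl] at hj
            rw [if_neg (by omega), if_neg (by omega)]
            exact hstack' j p hj
          · have hj2 := (List.getElem?_eq_some_iff.1 hj).1
            rw [List.length_append, List.length_map] at hj2
            rw [if_pos ⟨hjl, hj2⟩, if_pos ⟨hjl, hj2⟩]
            rw [List.getElem?_append_right hjl, List.getElem?_map, Option.map_eq_some_iff] at hj
            obtain ⟨ψ, -, rfl⟩ := hj
            exact ⟨rfl, rfl⟩
        reg6 := by rw [hreg' 6 (by decide), s6]
        two_le := h.two_le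
        le_two_add := by omega
        vertices := by
          intro p hp
          rcases List.mem_append.1 hp with hp | hp
          · exact hvert p hp
          · obtain ⟨ψ, -, rfl⟩ := List.mem_map.1 hp
            exact ⟨hu, hv, huv⟩
        unused := by rw [harrρ 1 (by decide), harr']; exact h.unused
        value_le := by
          rw [harrρ 1 (by decide), harr']
          exact fun z => (h.value_le z).trans hmono
        value := by
          rw [harrρ 1 (by decide), harr', process_append, process_add huv]
          exact hval }
  · refine Runs.cond hB (fun _ => Runs.cond hB (fun _ => ?_) (fun he2 => ?_))
      (fun he => absurd (ekind.symm.trans he) (by norm_num))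
    swap
    · simp only [Expr.eval] at ekind he2
      rw [ekind] at he2
      omega
    have hcode' : ((Δ' ++ [(a, w, v), (b, u, w)]).map fun p => p.1.encode).flatten = P := by
      simp [hPdef]
    have hlenΔ' := length_le_length_flatten_encode (Δ' ++ [(a, w, v), (b, u, w)])
    rw [hcode', List.length_append] at hlenΔ'
    simp only [List.length_cons, List.length_nil] at hlenΔ'
    refine Runs.mono (runs_mulGate hB s5 s6 s7 s8 (by omega) (by omega)) (by omega) ?_
    rintro ρ ⟨hBρ, ⟨hreg', harrρ⟩, hρ5, hρ6, hρ4, hρ5'⟩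
    refine ⟨Δ' ++ [(a, w, v), (b, u, w)], w + 1, ?_⟩
    exact
      { bounded := hBρ
        reg1 := by rw [hreg' 1 (by decide), s1]
        reg3 := by rw [hreg' 3 (by decide), s3]
        pow := by rw [harrρ 2 (by decide), harr']; exact h.pow
        count := by rw [harrρ 3 (by decide), harr']; exact h.count
        code := by rw [harrρ 0 (by decide), harr', h.code]
        reg2 := by rw [hreg' 2 (by decide), s2, hcode']
        done := by rw [hreg' 2 (by decide), s2, hPle]
        isPrefix := by rwa [hcode']
        reg5 := by simp [hρ5]
        stack := by
          intro j p hj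
          rw [hρ4, hρ5']
          rcases lt_or_ge j Δ'.length with hjl | hjl
          · rw [List.getElem?_append_left hjl] at hj
            rw [if_neg (by omega), if_neg (by omega), if_neg (by omega), if_neg (by omega)]
            exact hstack' j p hj
          · obtain ⟨d, rfl⟩ := Nat.exists_eq_add_of_le hjl
            rw [List.getElem?_append_right hjl, Nat.add_sub_cancel_left] at hj
            match d with
            | 0 => simp at hj; simp [← hj]
            | 1 => simp at hj; simp [← hj]
            | d + 2 => simp at hj
        reg6 := hρ6
        two_le := h.two_le.trans (Nat.le_succ w)
        le_two_add := by omega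
        vertices := by
          intro p hp
          rcases List.mem_append.1 hp with hp | hp
          · obtain ⟨h1, h2, h3⟩ := hvert p hp
            exact ⟨by omega, by omega, h3⟩
          · simp only [List.mem_cons, List.not_mem_nil, or_false] at hp
            rcases hp with rfl | rfl
            · exact ⟨by simp, by simp; omega, by simp; omega⟩
            · exact ⟨by simp; omega, by simp, by simp; omega⟩
        unused := by
          rw [harrρ 1 (by decide), harr']
          exact fun z hz => h.unused z ((Nat.mul_le_mul_right _ (Nat.le_succ w)).trans hz)
        value_le := by
          rw [harrρ 1 (by decide), harr']
          exact fun z => (h.value_le z).trans hmono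
        value := by
          rw [harrρ 1 (by decide), harr', process_append, ← hval]
          -- The leftover at w is invisible to the older pending nodes, and the result sits at
          -- vertex 1, which is below w.
          exact process_congr Δ' (fun p hp => ⟨(hvert p hp).1, (hvert p hp).2.1⟩)
            (process_mul hv a b (block_eq_zero h.unused)) 1 h.two_le }

/-! ### The whole program -/

namespace Code

/-- Tabulate powers of two. -/
def powTable (r : ℕ) : Program :=
  .loop (.sub (.add (.mul (.mul (.mul (.const 2) (.reg 0)) (.const r)) (.reg 1)) (.reg 1)) (.reg 4))
    (.seq (.store 2 (.add (.reg 4) (.const 1)) (.mul (.load 2 (.reg 4)) (.const 2))) incr)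

/-- Tabulate bit counts. -/
def countTable : Program :=
  .loop (.sub (.reg 3) (.reg 4))
    (.seq (.store 3 (.reg 4)
      (.add (.load 3 (.div (.reg 4) (.const 2))) (.mod (.reg 4) (.const 2)))) incr)

/-- Prepare the tables, the stack and the value of the first vertex. -/
def prepare (r : ℕ) : Program :=
  .seq (.store 2 (.const 0) (.const 1)) (.seq (powTable r) (.seq (.assign 3 (.load 2 (.reg 1)))
    (.seq (.assign 4 (.const 0)) (.seq countTable (.seq (.store 1 (.const 0) (.const 1))
      (.seq (.store 5 (.const 0) (.const 1)) (.seq (.assign 5 (.const 1))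
        (.assign 6 (.const 2)))))))))

/-- Compare the two signs of the top coefficient of the second vertex. -/
def answer : Program :=
  .cond (.sub (.load 1 (.sub (.mul dimE (.const 2)) (.const 2)))
    (.load 1 (.sub (.mul dimE (.const 2)) (.const 1)))) (.assign 0 (.const 1)) (.assign 0 (.const 0))

/-- The program that detects monomials with exponents at most `r`. -/
def full (r : ℕ) : Program := .seq (prepare r) (.seq (.loop (.reg 2) (node r)) answer)

end Code

/-- Transition coefficients need exponents up to 2 * n * r * k; the extra k guarantees 2^k and the
single-bit masks even if n * r = 0. -/
theorem runs_powTable {L n k r : ℕ} {σ : Memory} (hB : Bounded L σ) (h0 : σ.reg 0 = n)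
    (h1 : σ.reg 1 = k) (h4 : σ.reg 4 = 0) (h2 : σ.arr 2 0 = 1) (hL : 2 * n * r * k + k < L) :
    Runs L (Code.powTable r) σ ((2 * n * r * k + k) * 3 + 1) fun τ => Bounded L τ ∧
      SameExcept [4] [2] σ τ ∧ ∀ m ≤ 2 * n * r * k + k, τ.arr 2 m = 2 ^ m := by
  let I : ℕ → Memory → Prop := fun c τ => Bounded L τ ∧ τ.reg 4 = c ∧
      SameExcept [4] [2] σ τ ∧ ∀ m ≤ c, τ.arr 2 m = 2 ^ m
  have main : Runs L (Code.powTable r) σ ((2 * n * r * k + k) * (2 + 1) + 1)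
      (I (2 * n * r * k + k)) := by
    refine Runs.loop I ?_ ?_ ⟨hB, h4, ⟨fun _ _ => rfl, fun _ _ => rfl⟩, ?_⟩
    · rintro c hc τ ⟨hBτ, hc4, ⟨hreg, harr⟩, hτ⟩
      have g0 : τ.reg 0 = n := by rw [hreg 0 (by decide), h0]
      have g1 : τ.reg 1 = k := by rw [hreg 1 (by decide), h1]
      have b1 := hBτ.setArr 2 (c + 1) (v := 2 ^ c * 2)
        (by rw [← pow_succ]; exact Nat.pow_lt_pow_right (by norm_num) (by omega))
      have b2 := b1.setReg 4 (v := c + 1)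
        (lt_of_le_of_lt (by omega : c + 1 ≤ L) Nat.lt_two_pow_self)
      refine ⟨hBτ, by simp only [Expr.eval, g0, g1, hc4]; omega, ?_⟩
      refine Runs.seq (N := 1) (N' := 1) (Runs.store hBτ ?_)
      simp only [Expr.eval, hc4, hτ c le_rfl]
      refine Runs.assign b1 ?_
      simp only [Expr.eval, Memory.setArr_reg, hc4]
      refine ⟨b2, by simp, ⟨fun y hy => ?_, fun a ha => ?_⟩, fun m hm => ?_⟩
      · simp only [List.mem_cons, List.not_mem_nil, or_false] at hy
        simp [hy, hreg y (by simp [hy])]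
      · simp only [List.mem_cons, List.not_mem_nil, or_false] at ha
        funext j
        simp [ha, harr a (by simp [ha])]
      · rcases eq_or_ne m (c + 1) with rfl | hne
        · simp [pow_succ]
        · simp [hne, hτ m (by omega)]
    · rintro τ ⟨hBτ, hc4, ⟨hreg, harr⟩, -⟩
      refine ⟨hBτ, ?_⟩
      simp only [Expr.eval, hc4, hreg 0 (by decide), hreg 1 (by decide), h0, h1, Nat.sub_self]
    · intro m hm
      obtain rfl : m = 0 := by omega
      simpa using h2
  exact main.mono le_rfl fun τ h => ⟨h.1, h.2.2.1, h.2.2.2⟩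

theorem runs_countTable {L k : ℕ} {σ : Memory} (hB : Bounded L σ) (h3 : σ.reg 3 = 2 ^ k)
    (h4 : σ.reg 4 = 0) (h0 : σ.arr 3 0 = 0) :
    Runs L Code.countTable σ (2 ^ k * 3 + 1) fun τ => Bounded L τ ∧
      SameExcept [4] [3] σ τ ∧ ∀ m < 2 ^ k, τ.arr 3 m = bitCount m := by
  let I : ℕ → Memory → Prop := fun c τ => Bounded L τ ∧ τ.reg 4 = c ∧
      -- The separate clause for cell 0 serves c = 0, where c / 2 = c is read before it is written.
      SameExcept [4] [3] σ τ ∧ τ.arr 3 0 = 0 ∧ ∀ m < c, τ.arr 3 m = bitCount m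
  have main : Runs L Code.countTable σ (2 ^ k * (2 + 1) + 1) (I (2 ^ k)) := by
    refine Runs.loop I ?_ ?_ ⟨hB, h4, ⟨fun _ _ => rfl, fun _ _ => rfl⟩, h0, by simp⟩
    · rintro c hc τ ⟨hBτ, hc4, ⟨hreg, harr⟩, hτ0, hτ⟩
      have g3 : τ.reg 3 = 2 ^ k := by rw [hreg 3 (by decide), h3]
      have l3 := hBτ.reg_lt 3
      have lc := bitCount_lt c
      have b1 := hBτ.setArr 3 c (v := bitCount c) (by omega)
      have b2 := b1.setReg 4 (v := c + 1) (by omega)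
      have hhalf : τ.arr 3 (c / 2) = bitCount (c / 2) := by
        rcases eq_or_ne c 0 with rfl | hne
        · simpa [bitCount_zero] using hτ0
        · exact hτ _ (by omega)
      refine ⟨hBτ, by simp only [Expr.eval, g3, hc4]; omega, ?_⟩
      refine Runs.seq (N := 1) (N' := 1) (Runs.store hBτ ?_)
      simp only [Expr.eval, Expr.eval_mod, hc4, hhalf, ← bitCount_eq]
      refine Runs.assign b1 ?_
      simp only [Expr.eval, Memory.setArr_reg, hc4]
      refine ⟨b2, by simp, ⟨fun y hy => ?_, fun a ha => ?_⟩, ?_, fun m hm => ?_⟩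
      · simp only [List.mem_cons, List.not_mem_nil, or_false] at hy
        simp [hy, hreg y (by simp [hy])]
      · simp only [List.mem_cons, List.not_mem_nil, or_false] at ha
        funext j
        simp [ha, harr a (by simp [ha])]
      · rcases eq_or_ne c 0 with rfl | hne
        · simp [bitCount_zero]
        · simp [hne.symm, hτ0]
      · rcases eq_or_ne m c with rfl | hne
        · simp
        · simp [hne, hτ m (by omega)]
    · rintro τ ⟨hBτ, hc4, ⟨hreg, harr⟩, -⟩
      refine ⟨hBτ, ?_⟩
      simp only [Expr.eval, hc4, hreg 3 (by decide), h3, Nat.sub_self]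
  exact main.mono le_rfl fun τ h => ⟨h.1, h.2.2.1, h.2.2.2.2⟩

theorem bounded_input {n L : ℕ} (k : ℕ) (φ : Formula n) (h1 : 1 ≤ L) (hn : n + φ.nodes + 1 < 2 ^ L)
    (hk : k < 2 ^ L) (hl : 2 * φ.nodes < 2 ^ L) : Bounded L (input k φ) where
  one_le := h1
  reg_lt x := by
    simp only [input]
    split_ifs
    · omega
    · exact hk
    · rwa [φ.length_encode]
    · positivity
  arr_lt a i := by
    simp only [input]
    split_ifs
    · rw [List.getD_eq_getElem?_getD]
      rcases h : φ.encode[i]? with _ | x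
      · simp
      · exact (φ.le_of_mem_encode x (List.mem_of_getElem? h)).trans_lt hn
    · positivity

/-- Vertex 0 is the global source and holds the unit state 0 (empty masks, sign plus); vertex 1 is
the global sink. The stacked source 0 needs no write, since memory starts at zero. -/
theorem runs_prepare {n k r g L : ℕ} {φ : Formula n} (hP : Params n k r φ.nodes g L)
    (hB : Bounded L (input k φ)) (hL : 2 * n * r * k + k < L) :
    Runs L (Code.prepare r) (input k φ)
      (1 + ((2 * n * r * k + k) * 3 + 1 + (1 + (1 + (2 ^ k * 3 + 1 + (1 + (1 + (1 + 1)))))))) fun τ =>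
      MainInv k r g L φ 0 τ [(φ, 0, 1)] 2 := by
  have h2 : 2 < 2 ^ L := by have := hP.stack; omega
  have b1 := hB.setArr 2 0 (v := 1) (by omega)
  refine Runs.seq (Runs.store hB ?_)
  simp only [Expr.eval]
  refine Runs.seq (Runs.mono (runs_powTable (n := n) (k := k) b1 (by simp [input])
    (by simp [input]) (by simp [input]) (by simp) hL) le_rfl ?_)
  rintro σ ⟨hBσ, ⟨hreg, harr⟩, hpow⟩
  have s1 : σ.reg 1 = k := by rw [hreg 1 (by decide)]; simp [input]
  have s2 : σ.reg 2 = φ.encode.length := by rw [hreg 2 (by decide)]; simp [input]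
  have a0 : σ.arr 0 = fun j => φ.encode.getD j 0 := by
    rw [harr 0 (by decide)]; funext j; simp [input]
  have az : ∀ a, a ≠ 0 → a ≠ 2 → ∀ j, σ.arr a j = 0 := by
    intro a h0 h2 j
    rw [harr a (by simpa using h2)]
    simp [input, h0, h2]
  have b2 := hBσ.setReg 3 (v := 2 ^ k) (Nat.pow_lt_pow_right (by norm_num) (by omega))
  have b3 := b2.setReg 4 (v := 0) (by positivity)
  refine Runs.seq (Runs.assign hBσ ?_)
  simp only [Expr.eval, s1, hpow k (Nat.le_add_left _ _)]
  refine Runs.seq (Runs.assign b2 ?_)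
  simp only [Expr.eval]
  refine Runs.seq (Runs.mono (runs_countTable (k := k) b3 (by simp) (by simp)
    (by simp [az 3])) le_rfl ?_)
  rintro ρ ⟨hBρ, ⟨hregρ, harrρ⟩, hcount⟩
  have c1 := hBρ.setArr 1 0 (v := 1) (by omega)
  have c2 := c1.setArr 5 0 (v := 1) (by omega)
  have c3 := c2.setReg 5 (v := 1) (by omega)
  have c4 := c3.setReg 6 (v := 2) h2
  refine Runs.seq (Runs.store hBρ ?_)
  simp only [Expr.eval]
  refine Runs.seq (Runs.store c1 ?_)
  simp only [Expr.eval]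
  refine Runs.seq (Runs.assign c2 ?_)
  simp only [Expr.eval]
  refine Runs.assign c3 ?_
  simp only [Expr.eval]
  have hρ1 : ∀ j, ρ.arr 1 j = 0 := by
    intro j; rw [harrρ 1 (by decide)]; simp [az 1]
  have hρ4 : ∀ j, ρ.arr 4 j = 0 := by
    intro j; rw [harrρ 4 (by decide)]; simp [az 4]
  have hρ2 : ρ.reg 2 = φ.encode.length := by rw [hregρ 2 (by decide)]; simp [s2]
  have hdim : 0 < dim k := by rw [dim]; positivity
  exact
    { bounded := c4
      reg1 := by simp [hregρ 1, s1]
      reg3 := by simp [hregρ 3]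
      pow := by
        intro m hm
        simp [harrρ 2, hpow m hm]
      count := by
        intro m hm
        simp [hcount m hm]
      code := by
        funext j
        simp [harrρ 0, a0]
      reg2 := by simp [hρ2]
      done := by simp [hρ2, φ.length_encode]
      isPrefix := by simp
      reg5 := by simp
      stack := by
        intro j p hj
        match j with
        | 0 => simp at hj; simp [← hj, hρ4]
        | j + 1 => simp at hj
      reg6 := by simp
      two_le := le_rfl
      le_two_add := le_rfl
      vertices := by simp
      unused := by
        intro z hz
        have : z ≠ 0 := by omega
        simp [this, hρ1]
      value_le := by
        intro z
        simp only [Memory.setReg_arr, Memory.setArr_arr, hρ1, mul_zero, pow_zero]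
        split_ifs <;> omega
      value := by
        have e0 : block k (((((ρ.setArr 1 0 1).setArr 5 0 1).setReg 5 1).setReg 6 2).arr 1) 0 =
            Pi.single 0 1 := by
          funext X
          rcases eq_or_ne X 0 with rfl | hX
          · simp [block, hdim]
          · simp [block, hX, hρ1]
        have e1 : block k (((((ρ.setArr 1 0 1).setArr 5 0 1).setReg 5 1).setReg 6 2).arr 1) 1 =
            0 := by
          funext X
          simp [block, hdim.ne', hρ1]
        simp only [process, List.foldr_cons, List.foldr_nil, Function.update_self, e0, e1,
          zero_add] }

/-- The number of steps of the program. -/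
def stepBound (n k r N : ℕ) : ℕ :=
  (1 + ((2 * n * r * k + k) * 3 + 1 + (1 + (1 + (2 ^ k * 3 + 1 + (1 + (1 + (1 + 1)))))))) +
    (N * (6 + (dim k * k * k * r * 4 + 10 * N + 6 + 1 + 1) + 1) + 1 + (1 + 1))

/-- Each iteration consumes two code entries, so there is one per node. At the end nothing is
pending, and vertex 1 holds the formula applied to the unit state. -/
theorem runs_full {n k r g L : ℕ} {φ : Formula n} (hP : Params n k r φ.nodes g L)
    (hB : Bounded L (input k φ)) (hL : 2 * n * r * k + k < L) :
    Runs L (Code.full r) (input k φ) (stepBound n k r φ.nodes) fun τ =>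
      (HasQMonomial (r + 1) k φ.toPoly → τ.reg 0 = 1) ∧
      (¬ HasQMonomial (r + 1) k φ.toPoly → τ.reg 0 = 0) := by
  refine Runs.seq (Runs.mono (runs_prepare hP hB hL) le_rfl fun σ hσ => Runs.seq ?_)
  refine Runs.mono (Runs.loop (fun i τ => ∃ Δ w, MainInv k r g L φ i τ Δ w) ?_ ?_
    ⟨_, _, hσ⟩) le_rfl ?_
  · rintro i hi τ ⟨Δ, w, h⟩
    refine ⟨h.bounded, ?_, runs_node hP hi h⟩
    have := h.done
    simp only [Expr.eval]
    omega
  · rintro τ ⟨Δ, w, h⟩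
    have := h.done
    refine ⟨h.bounded, ?_⟩
    simp only [Expr.eval]
    omega
  · rintro τ ⟨Δ, w, h⟩
    have hΔ : Δ = [] := by
      have h1 := length_le_length_flatten_encode Δ
      have h2 := h.done
      rw [← h.reg2] at h1
      exact List.length_eq_zero_iff.1 (by omega)
    subst hΔ
    have hval := h.value
    simp only [process, List.foldr_nil] at hval
    have hd : 2 ≤ dim k := by
      have : 0 < 2 ^ k * 2 ^ k := by positivity
      rw [dim]; omega
    have ed : Code.dimE.eval τ = dim k := by simp only [Code.dimE, Expr.eval, h.reg3, dim]
    -- Vertex 1 occupies the addresses from `dim k` to `dim k * 2 - 1`, ending with its two top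
    -- states.
    have hread : ∀ d, 0 < d → d ≤ 2 → τ.arr 1 (dim k * 2 - d) =
        φ.evalIn (fun i : Fin n => leafOp k r i) (Pi.single 0 1) (dim k - d) := by
      intro d hd1 hd2
      rw [← hval, block, if_pos (by omega)]
      congr 1
      omega
    -- Truncated subtraction is nonzero exactly when the positive part exceeds the negative one.
    have eans : (Expr.sub (.load 1 (.sub (.mul Code.dimE (.const 2)) (.const 2)))
        (.load 1 (.sub (.mul Code.dimE (.const 2)) (.const 1)))).eval τ =
        φ.evalIn (fun i : Fin n => leafOp k r i) (Pi.single 0 1) (dim k - 2) -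
          φ.evalIn (fun i : Fin n => leafOp k r i) (Pi.single 0 1) (dim k - 1) := by
      simp only [Expr.eval, ed]
      rw [hread 2 (by norm_num) le_rfl, hread 1 (by norm_num) (by norm_num)]
    rw [hasQMonomial_iff_states]
    refine Runs.cond h.bounded (fun hne => Runs.assign h.bounded ?_)
      (fun he => Runs.assign h.bounded ?_)
    · rw [eans] at hne
      simp only [Expr.eval, Memory.setReg_reg, if_true]
      exact ⟨fun _ => trivial, fun hlt => absurd (by omega) hlt⟩
    · rw [eans] at he
      simp only [Expr.eval, Memory.setReg_reg, if_true]
      exact ⟨fun hlt => absurd hlt (by omega), fun _ => trivial⟩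

/-! ### The running time -/

/-- A bound for the growth of bit lengths per node. -/
def growthBound (n k r : ℕ) : ℕ := 2 * n * r * k + 4 * k + r + 2

/-- A bound for all bit lengths. -/
def bitBound (n k r N : ℕ) : ℕ := growthBound n k r * (N + 1) + 2 * N + n + k + 4

/-- The crude k ≤ 2^k and r ≤ 2^r suffice, because this bound enters only through bit lengths. -/
theorem leaves_mul_le (n k r : ℕ) :
    dim k * k * k * r * 2 ^ (2 * n * r * k) ≤ 2 ^ (2 * n * r * k + 4 * k + r + 1) := by
  have hk : k ≤ 2 ^ k := Nat.lt_two_pow_self.le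
  have hr : r ≤ 2 ^ r := Nat.lt_two_pow_self.le
  calc dim k * k * k * r * 2 ^ (2 * n * r * k)
      ≤ dim k * 2 ^ k * 2 ^ k * 2 ^ r * 2 ^ (2 * n * r * k) := by gcongr
    _ = 2 ^ (2 * n * r * k + 4 * k + r + 1) := by
      rw [dim, show 2 * n * r * k + 4 * k + r + 1 = k + k + 1 + k + k + r + 2 * n * r * k by ring]
      simp only [pow_add, pow_one]

theorem params_bitBound (n k r N : ℕ) :
    Params n k r N (growthBound n k r) (bitBound n k r N) where
  growth := by
    have h := leaves_mul_le n k r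
    have h1 : 1 ≤ 2 ^ (2 * n * r * k + 4 * k + r + 1) := Nat.one_le_two_pow
    rw [growthBound, pow_succ _ (2 * n * r * k + 4 * k + r + 1)]
    omega
  values := by
    rw [bitBound, mul_add]
    omega
  leaves := by
    have h := leaves_mul_le n k r
    have h1 : dim k * k * k * r ≤ dim k * k * k * r * 2 ^ (2 * n * r * k) :=
      Nat.le_mul_of_pos_right _ (by positivity)
    refine (h1.trans h).trans_lt (Nat.pow_lt_pow_right (by norm_num) ?_)
    rw [bitBound, growthBound, mul_add]
    omega
  stack := by
    refine lt_of_lt_of_le Nat.lt_two_pow_self (Nat.pow_le_pow_right (by norm_num) ?_)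
    rw [bitBound]
    omega

theorem bitBound_le {n k r N S : ℕ} (hr : 1 ≤ r) (hS : 1 ≤ S) (hN : N ≤ 3 * (n + k + 1) * S) :
    bitBound n k r N ≤ 50 * r * (n + k + 1) ^ 3 * S := by
  obtain ⟨z, hz⟩ : ∃ z, z = n + k + 1 := ⟨_, rfl⟩
  rw [← hz] at hN ⊢
  have hz1 : 1 ≤ z := by omega
  have hnk : n * k ≤ z ^ 2 := by rw [sq]; exact Nat.mul_le_mul (by omega) (by omega)
  have hzz : z ≤ z ^ 2 := Nat.le_self_pow (by norm_num) z
  have hrz : z ^ 2 ≤ r * z ^ 2 := Nat.le_mul_of_pos_left _ hr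
  have hrz' : r ≤ r * z ^ 2 := Nat.le_mul_of_pos_right _ (by positivity)
  have hg : growthBound n k r ≤ 9 * (r * z ^ 2) := by
    have : 2 * n * r * k ≤ 2 * (r * z ^ 2) := by
      calc 2 * n * r * k = 2 * (r * (n * k)) := by ring
        _ ≤ _ := by gcongr
    rw [growthBound]
    omega
  have hzS : z ≤ z * S := Nat.le_mul_of_pos_right _ hS
  have hN1 : N + 1 ≤ 4 * (z * S) := by
    have : 3 * z * S = 3 * (z * S) := by ring
    omega
  have hbig : z * S ≤ r * z ^ 3 * S := by
    refine Nat.mul_le_mul_right _ ?_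
    calc z ≤ z ^ 3 := Nat.le_self_pow (by norm_num) z
      _ ≤ r * z ^ 3 := Nat.le_mul_of_pos_left _ hr
  have hprod : growthBound n k r * (N + 1) ≤ 36 * (r * z ^ 3 * S) := by
    calc growthBound n k r * (N + 1) ≤ 9 * (r * z ^ 2) * (4 * (z * S)) := Nat.mul_le_mul hg hN1
      _ = _ := by ring
  have : 50 * r * z ^ 3 * S = 50 * (r * z ^ 3 * S) := by ring
  rw [bitBound, this]
  omega

/-- The factor 4^k comes with N leaf loops; the square of S comes from the crude allowance of 10 * N
steps per node for pushing children. -/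
theorem stepBound_le {n k r N S : ℕ} (hr : 1 ≤ r) (hS : 1 ≤ S) (hN : N ≤ 3 * (n + k + 1) * S) :
    stepBound n k r N ≤ 300 * r * (n + k + 1) ^ 3 * 4 ^ k * S ^ 2 := by
  obtain ⟨z, hz⟩ : ∃ z, z = n + k + 1 := ⟨_, rfl⟩
  rw [← hz] at hN ⊢
  have hz1 : 1 ≤ z := by omega
  have hQ : 1 ≤ 4 ^ k := Nat.one_le_pow _ _ (by norm_num)
  have hdim : dim k = 2 * 4 ^ k := by
    rw [dim, ← mul_pow, mul_comm]
    norm_num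
  have hM : dim k * k * k * r ≤ 2 * (r * z ^ 2 * 4 ^ k) := by
    calc dim k * k * k * r = 2 * (r * (k * k) * 4 ^ k) := by rw [hdim]; ring
      _ ≤ 2 * (r * (z * z) * 4 ^ k) := by gcongr <;> omega
      _ = _ := by ring
  -- Every summand is majorized by a multiple of the single monomial U.
  have hU : ∀ a b c, a ≤ z ^ 3 → b ≤ 4 ^ k → c ≤ S ^ 2 → ∀ d ≤ r,
      d * a * b * c ≤ r * z ^ 3 * 4 ^ k * S ^ 2 := by
    intro a b c ha hb hc d hd
    gcongr
  set U := r * z ^ 3 * 4 ^ k * S ^ 2 with hUdef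
  have hz3 : 1 ≤ z ^ 3 := Nat.one_le_pow _ _ hz1
  have hS2 : 1 ≤ S ^ 2 := Nat.one_le_pow _ _ hS
  have hSS : S ≤ S ^ 2 := Nat.le_self_pow (by norm_num) S
  have hzz : z ≤ z ^ 3 := Nat.le_self_pow (by norm_num) z
  have hzz2 : z ^ 2 ≤ z ^ 3 := Nat.pow_le_pow_right hz1 (by norm_num)
  have h1 : 1 ≤ U := by simpa using hU 1 1 1 hz3 hQ hS2 1 hr
  have h2 : 2 ^ k ≤ U := by
    have : 2 ^ k ≤ 4 ^ k := Nat.pow_le_pow_left (by norm_num) k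
    simpa using hU 1 (2 ^ k) 1 hz3 this hS2 1 hr
  have h3 : k ≤ U := by simpa using hU k 1 1 (by omega) hQ hS2 1 hr
  have h4 : 2 * n * r * k ≤ 2 * U := by
    have : n * k ≤ z ^ 3 := by
      refine le_trans ?_ hzz2
      rw [sq]; exact Nat.mul_le_mul (by omega) (by omega)
    have h5 := hU (n * k) 1 1 this hQ hS2 r le_rfl
    calc 2 * n * r * k = 2 * (r * (n * k) * 1 * 1) := by ring
      _ ≤ _ := Nat.mul_le_mul_left _ h5
  have h5 : N * (dim k * k * k * r * 4) ≤ 24 * U := by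
    calc N * (dim k * k * k * r * 4) ≤ (3 * z * S) * (2 * (r * z ^ 2 * 4 ^ k) * 4) := by gcongr
      _ = 24 * (r * z ^ 3 * 4 ^ k * S) := by ring
      _ ≤ 24 * U := Nat.mul_le_mul_left _ (hU _ _ _ le_rfl le_rfl hSS r le_rfl)
  have h6 : N * (10 * N) ≤ 90 * U := by
    calc N * (10 * N) ≤ (3 * z * S) * (10 * (3 * z * S)) := by gcongr
      _ = 90 * (1 * z ^ 2 * 1 * S ^ 2) := by ring
      _ ≤ 90 * U := Nat.mul_le_mul_left _ (hU _ _ _ hzz2 hQ le_rfl 1 hr)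
  have h7 : N ≤ 3 * U := by
    calc N ≤ 3 * z * S := hN
      _ = 3 * (1 * z * 1 * S) := by ring
      _ ≤ 3 * U := Nat.mul_le_mul_left _ (hU _ _ _ hzz hQ hSS 1 hr)
  have h8 : N * (6 + (dim k * k * k * r * 4 + 10 * N + 6 + 1 + 1) + 1) =
      N * (dim k * k * k * r * 4) + N * (10 * N) + 15 * N := by ring
  have h9 : 300 * r * z ^ 3 * 4 ^ k * S ^ 2 = 300 * U := by rw [hUdef]; ring
  rw [stepBound, h8, h9]
  omega

end QMonomial

theorem theorem1 (q : ℕ) (hq : 2 ≤ q) :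
    ∃ (P : QMonomial.Program) (C c : ℕ),
      ∀ (n k : ℕ) (φ : QMonomial.Formula n), φ.IsSimple →
        ∃ (τ : QMonomial.Memory) (t : ℕ),
          QMonomial.Exec P (QMonomial.input k φ) τ t ∧
          (QMonomial.HasQMonomial q k φ.toPoly → τ.reg 0 = 1) ∧
          (¬ QMonomial.HasQMonomial q k φ.toPoly → τ.reg 0 = 0) ∧
          (t : ℝ) ≤ C * ((n : ℝ) + k + 1) ^ c * (5.44 : ℝ) ^ k * (max φ.size 1 : ℕ) ^ 4 := by
  obtain ⟨r, rfl⟩ : ∃ r, q = r + 1 := ⟨q - 1, by omega⟩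
  have hr : 1 ≤ r := by omega
  -- The time is weight * L^2 * steps: 750000 = 50^2 * 300, r^3 = r^2 * r, and the exponent 9 is 2 *
  -- 3 + 3.
  refine ⟨QMonomial.Code.full r, (QMonomial.Code.full r).weight * 750000 * r ^ 3, 9,
    fun n k φ hφ => ?_⟩
  obtain ⟨S, hS⟩ : ∃ S, S = max φ.size 1 := ⟨_, rfl⟩
  have hS1 : 1 ≤ S := by omega
  have hN : φ.nodes ≤ 3 * (n + k + 1) * S := by
    rw [hS]
    exact (φ.nodes_le_mul_max hφ).trans (Nat.mul_le_mul_right _ (by omega))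
  have hP := QMonomial.params_bitBound n k r φ.nodes
  have hbit : ∀ m, m ≤ QMonomial.bitBound n k r φ.nodes →
      m < 2 ^ QMonomial.bitBound n k r φ.nodes := fun m hm => hm.trans_lt Nat.lt_two_pow_self
  have hge : 2 * n * r * k + k + n + 2 * φ.nodes + 4 ≤ QMonomial.bitBound n k r φ.nodes := by
    have : 2 * n * r * k ≤ QMonomial.growthBound n k r * (φ.nodes + 1) := by
      refine le_trans ?_ (Nat.le_mul_of_pos_right _ (Nat.succ_pos _))
      rw [QMonomial.growthBound]
      omega
    rw [QMonomial.bitBound]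
    omega
  have hB := QMonomial.bounded_input (L := QMonomial.bitBound n k r φ.nodes) k φ (by omega)
    (hbit _ (by omega)) (hbit _ (by omega)) (hbit _ (by omega))
  obtain ⟨τ, t, hexec, ht, hyes, hno⟩ := QMonomial.runs_full hP hB (by omega)
  refine ⟨τ, t, hexec, hyes, hno, ?_⟩
  have hL := QMonomial.bitBound_le hr hS1 hN
  have hT := QMonomial.stepBound_le hr hS1 hN
  have hnat : t ≤ (QMonomial.Code.full r).weight * 750000 * r ^ 3 * (n + k + 1) ^ 9 * 4 ^ k *
      S ^ 4 := by
    calc t ≤ (QMonomial.Code.full r).weight * (50 * r * (n + k + 1) ^ 3 * S) ^ 2 *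
          (300 * r * (n + k + 1) ^ 3 * 4 ^ k * S ^ 2) :=
          ht.trans (Nat.mul_le_mul (Nat.mul_le_mul_left _ (Nat.pow_le_pow_left hL 2)) hT)
      _ = _ := by ring
  rw [← hS]
  generalize (QMonomial.Code.full r).weight * 750000 * r ^ 3 = C at hnat ⊢
  calc (t : ℝ) ≤ (C * (n + k + 1) ^ 9 * 4 ^ k * S ^ 4 : ℕ) := by exact_mod_cast hnat
    _ = C * ((n : ℝ) + k + 1) ^ 9 * 4 ^ k * (S : ℝ) ^ 4 := by push_cast; ring
    -- The method achieves base 4; only here is it weakened to 5.44.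
    _ ≤ C * ((n : ℝ) + k + 1) ^ 9 * 5.44 ^ k * (S : ℝ) ^ 4 := by gcongr; norm_num
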